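/- A time bound is a function $f:\mathbb N\to\mathbb N$ with $n\le f(n)\le f(n+1)$ for all $n$. A $b$-tape DTM is a deterministic Turing machine with a two-way read-only input tape (the input being enclosed by end markers) and $b$ additional work tapes. For $b\in\mathbb N$, let $\mathrm{DTIME}_b(f)$ be the class of all languages over finite alphabets that are accepted by a $b$-tape DTM whose time complexity $t$ (the maximal number of steps until it halts on inputs of length $n$) satisfies $t\in O(f)$, and let $\mathrm{DTIME}(f)=\bigcup_{b\in\mathbb N}\mathrm{DTIME}_b(f)$. A time bound $g$ is time-constructible by a $b$-tape DTM if there is a $b$-tape DTM that, on every input word $w$, writes the word $1^{g(|w|)}$ on one of its work tapes and halts after at most $t(|w|)$ steps, where $t\in O(g)$. Let $f$ and $g$ be time bounds and $b_0,b_g\in\mathbb N$. If $\mathrm{DTIME}(f)=\mathrm{DTIME}_{b_0}(f)$ and $g$ is time-constructible by a $b_g$-tape DTM, then $$\mathrm{DTIME}(f\circ g)=\mathrm{DTIME}_{\max(b_0,b_g)+1}(f\circ g).$$ -/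

import Mathlib

open Filter Asymptotics

namespace TapeTime

/-- A time bound is a function `f : ℕ → ℕ` with `n ≤ f n ≤ f (n + 1)` for all `n`. -/
def IsTimeBound (f : ℕ → ℕ) : Prop :=
  ∀ n, n ≤ f n ∧ f n ≤ f (n + 1)

/-- Head movements. -/
inductive Move where
  | left
  | stay
  | right

/-- The contents of a cell of the input tape: the input word is enclosed by two end markers. -/
inductive InSym (α : Type) where
  | leftEnd
  | letter (a : α)
  | rightEnd

/-- The input cell at position `p`, for the input word `w`: the left marker is at position `0`,
the letters of `w` are at the positions `1, …, |w|`, the right marker is at `|w| + 1`. -/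
def inputAt {α : Type} (w : List α) : ℕ → InSym α
  | 0 => InSym.leftEnd
  | p + 1 => (w[p]?).elim InSym.rightEnd InSym.letter

/-- Movement of the input head on an input of length `n`. The head never leaves the cells
`0, …, n + 1`: a move beyond an end marker has no effect. -/
def moveInput (n : ℕ) (p : ℕ) : Move → ℕ
  | Move.left => p - 1
  | Move.stay => p
  | Move.right => min (p + 1) (n + 1)

/-- Movement of a head on a two-way infinite work tape. -/
def moveWork (z : ℤ) : Move → ℤ
  | Move.left => z - 1
  | Move.stay => z
  | Move.right => z + 1

/-- A deterministic Turing machine with input alphabet `α`, a read-only two-way input tape and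
`b` work tapes (two-way infinite, read-write). In one step, depending on the state and on the
symbols scanned on the input tape and on the work tapes, it changes the state, moves the input
head, and prints a symbol and moves the head on each work tape. It halts where `trans` is
undefined. -/
structure DTM (α : Type) (b : ℕ) where
  /-- the states -/
  State : Type
  /-- the symbols of the work tapes -/
  Sym : Type
  finState : Finite State
  finSym : Finite Sym
  blank : Sym
  start : State
  accept : Set State
  trans : State → InSym α → (Fin b → Sym) → Option (State × Move × (Fin b → Sym × Move))

namespace DTM

variable {α : Type} {b : ℕ}

/-- A configuration (the input word is kept separately). -/
structure Cfg (M : DTM α b) where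
  state : M.State
  inHead : ℕ
  head : Fin b → ℤ
  tape : Fin b → ℤ → M.Sym

/-- The initial configuration: input head on the left marker, all work tapes blank. -/
def init (M : DTM α b) : M.Cfg where
  state := M.start
  inHead := 0
  head := fun _ => 0
  tape := fun _ _ => M.blank

/-- One step on input `w`; `none` if the machine halts in `c`. -/
def step (M : DTM α b) (w : List α) (c : M.Cfg) : Option M.Cfg :=
  (M.trans c.state (inputAt w c.inHead) (fun i => c.tape i (c.head i))).map fun r =>
    { state := r.1
      inHead := moveInput w.length c.inHead r.2.1
      head := fun i => moveWork (c.head i) (r.2.2 i).2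
      tape := fun i => Function.update (c.tape i) (c.head i) (r.2.2 i).1 }

/-- The machine halts in the configuration `c`. -/
def Halted (M : DTM α b) (w : List α) (c : M.Cfg) : Prop :=
  M.step w c = none

/-- The configuration reached on input `w` after `t` steps, or the halting configuration if the
machine halts earlier. -/
def run (M : DTM α b) (w : List α) : ℕ → M.Cfg
  | 0 => M.init
  | t + 1 => (M.step w (M.run w t)).getD (M.run w t)

/-- `M` halts on every input `w` after at most `T |w|` steps. -/
def HaltsWithin (M : DTM α b) (T : ℕ → ℕ) : Prop :=
  ∀ w : List α, M.Halted w (M.run w (T w.length))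

/-- `M` halts on `w` in an accepting state. -/
def Accepts (M : DTM α b) (w : List α) : Prop :=
  ∃ t, M.Halted w (M.run w t) ∧ (M.run w t).state ∈ M.accept

/-- The language accepted by `M`. -/
def language (M : DTM α b) : Language α :=
  {w | M.Accepts w}

/-- The time complexity of `M` (the maximal number of steps on inputs of length `n`) is finite
and belongs to `O(f)`. -/
def HasTime (M : DTM α b) (f : ℕ → ℕ) : Prop :=
  ∃ T : ℕ → ℕ, ((fun n => (T n : ℝ)) =O[atTop] fun n => (f n : ℝ)) ∧ M.HaltsWithin T

end DTM

/-- Languages over arbitrary finite alphabets; up to renaming of letters, a finite alphabet is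
`Fin k` for some `k`. -/
abbrev FinLanguage : Type := (k : ℕ) × Language (Fin k)

/-- `DTIME_b(f)`: the languages accepted by `b`-tape machines in time `O(f)`. -/
def DTIMEWith (b : ℕ) (f : ℕ → ℕ) : Set FinLanguage :=
  {L | ∃ M : DTM (Fin L.1) b, M.language = L.2 ∧ M.HasTime f}

/-- `DTIME(f)`: the languages accepted in time `O(f)` with any number of work tapes. -/
def DTIME (f : ℕ → ℕ) : Set FinLanguage :=
  ⋃ b : ℕ, DTIMEWith b f

/-- The tape inscription is the word consisting of `m` symbols `s`, at any place of the tape. -/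
def Inscription {Γ : Type} (blank s : Γ) (m : ℕ) (tape : ℤ → Γ) : Prop :=
  ∃ p : ℤ, ∀ z : ℤ,
    ((p ≤ z ∧ z < p + m) → tape z = s) ∧ (¬ (p ≤ z ∧ z < p + m) → tape z = blank)

/-- `g` is time-constructible by a `b`-tape machine: over some nonempty finite input alphabet,
there is a `b`-tape machine that on every input `w` halts after `O(g(|w|))` steps, with the word
`1^{g(|w|)}` on one of its work tapes (always the same one), where `1` is a fixed symbol
different from the blank. -/
def TimeConstructibleWith (b : ℕ) (g : ℕ → ℕ) : Prop :=
  ∃ (k : ℕ) (M : DTM (Fin (k + 1)) b) (i : Fin b) (one : M.Sym), one ≠ M.blank ∧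
    M.HasTime g ∧
    ∀ (w : List (Fin (k + 1))) (t : ℕ), M.Halted w (M.run w t) →
      Inscription M.blank one (g w.length) ((M.run w t).tape i)

end TapeTime

namespace TapeTime

/-! The proof is a padding argument. Let `L` be accepted in time `O(f ∘ g)` with any number of
tapes. The padded language consists of the words `x` of length `g n` whose prefix before the first
padding letter has length `n` and belongs to `L`; what follows the first padding letter is not
inspected.

The padded language is in `DTIME f` (`exists_machine_paddedLanguage`): check the length of `x`, then
run the machine for `L` on the prefix, in time `O(f (g n)) = O(f |x|)`. The check uses the machine
constructing `g`, which could run far longer than `|x|` if `x` has the wrong length; a clock stops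
it after `O(|x|)` steps, and running out of time proves that the length is wrong (`Prepares.clock`).
The number of tapes does not matter here, since the hypothesis on `f` then supplies a machine with
`b₀` tapes.

Conversely, from a `b₀`-tape machine for the padded language one gets a machine for `L`
(`exists_machine_of_paddedLanguage`): lay out the padded version of `w` on one extra tape, with
markers at `0` and `g |w| + 1`, and use that tape as the input tape. Constructing `g` and simulating
the `b₀`-tape machine happen on different tracks of the same tapes, so `max b₀ bg` tapes and the
extra one suffice.

To place the right marker, the head of the extra tape counts the symbols `1` on the output tape
while `g` is being constructed (`counting_spec`); it ends at position `g |w|` wherever the output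
stands. -/

variable {α β : Type} {b b' : ℕ}

/-! ### Elementary facts about head movements -/

theorem moveInput_le {n p : ℕ} (h : p ≤ n + 1) (m : Move) : moveInput n p m ≤ n + 1 := by
  cases m <;> simp only [moveInput] <;> omega

theorem moveWork_add (h o : ℤ) (m : Move) : moveWork (h + o) m = moveWork h m + o := by
  cases m <;> simp only [moveWork] <;> ring

/-- The movement `m` of an input head scanning `s`, with the moves beyond an end marker
suppressed. -/
def clamp (s : InSym α) (m : Move) : Move :=
  match s, m with
  | InSym.leftEnd, Move.left => Move.stay
  | InSym.rightEnd, Move.right => Move.stay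
  | _, m => m

theorem inputAt_zero (w : List α) : inputAt w 0 = InSym.leftEnd := rfl

theorem inputAt_succ_of_lt {w : List α} {p : ℕ} (h : p < w.length) :
    inputAt w (p + 1) = InSym.letter w[p] := by
  simp [inputAt, h]

theorem inputAt_of_length_lt {w : List α} {p : ℕ} (h : w.length < p) :
    inputAt w p = InSym.rightEnd := by
  obtain ⟨p, rfl⟩ := Nat.exists_eq_succ_of_ne_zero (by omega : p ≠ 0)
  simp [inputAt, List.getElem?_eq_none (by omega : w.length ≤ p)]

theorem inputAt_cases (w : List α) {p : ℕ} (hp : p ≤ w.length + 1) :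
    (p = 0 ∧ inputAt w p = InSym.leftEnd) ∨
    (1 ≤ p ∧ p ≤ w.length ∧ ∃ a, inputAt w p = InSym.letter a) ∨
    (p = w.length + 1 ∧ inputAt w p = InSym.rightEnd) := by
  rcases Nat.eq_zero_or_pos p with rfl | h0
  · exact Or.inl ⟨rfl, rfl⟩
  rcases Nat.lt_or_ge w.length p with h | h
  · exact Or.inr (Or.inr ⟨by omega, inputAt_of_length_lt h⟩)
  · obtain ⟨p, rfl⟩ := Nat.exists_eq_succ_of_ne_zero (by omega : p ≠ 0)
    exact Or.inr (Or.inl ⟨h0, h, _, inputAt_succ_of_lt (by omega)⟩)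

/-- A work tape has no ends. A machine whose input is stored on a work tape must itself suppress the
moves that the end markers of a genuine input tape would block. -/
theorem moveWork_clamp (w : List α) {p : ℕ} (hp : p ≤ w.length + 1) (m : Move) :
    moveWork (p : ℤ) (clamp (inputAt w p) m) = (moveInput w.length p m : ℕ) := by
  rcases inputAt_cases w hp with ⟨h, e⟩ | ⟨h, h', a, e⟩ | ⟨h, e⟩ <;> rw [e] <;> cases m <;>
    simp only [clamp, moveWork, moveInput] <;> omega

/-- Needed when only a prefix `w` of a longer input of length `n` is treated as the input: its right
end has to act as a barrier although the tape continues. -/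
theorem moveInput_clamp (w : List α) {n p : ℕ} (hn : w.length ≤ n) (hp : p ≤ w.length + 1)
    (m : Move) : moveInput n p (clamp (inputAt w p) m) = moveInput w.length p m := by
  rcases inputAt_cases w hp with ⟨h, e⟩ | ⟨h, h', a, e⟩ | ⟨h, e⟩ <;> rw [e] <;> cases m <;>
    simp only [clamp, moveInput] <;> omega

namespace DTM

/-! ### Reachability of configurations -/

/-- The configuration after executing the instruction `r`. -/
def after (M : DTM α b) (w : List α) (c : M.Cfg)
    (r : M.State × Move × (Fin b → M.Sym × Move)) : M.Cfg where
  state := r.1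
  inHead := moveInput w.length c.inHead r.2.1
  head := fun i => moveWork (c.head i) (r.2.2 i).2
  tape := fun i => Function.update (c.tape i) (c.head i) (r.2.2 i).1

/-- The instruction applicable in a configuration. -/
def instr (M : DTM α b) (w : List α) (c : M.Cfg) :
    Option (M.State × Move × (Fin b → M.Sym × Move)) :=
  M.trans c.state (inputAt w c.inHead) (fun i => c.tape i (c.head i))

theorem step_eq (M : DTM α b) (w : List α) (c : M.Cfg) :
    M.step w c = (M.instr w c).map (M.after w c) := rfl

theorem halted_iff {M : DTM α b} {w : List α} {c : M.Cfg} :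
    M.Halted w c ↔ M.instr w c = none := by
  simp [Halted, step_eq]

/-- One step, where halting configurations are fixed. -/
def next (M : DTM α b) (w : List α) (c : M.Cfg) : M.Cfg :=
  (M.step w c).getD c

theorem next_of_instr {M : DTM α b} {w : List α} {c : M.Cfg} {r} (h : M.instr w c = some r) :
    M.next w c = M.after w c r := by
  simp [next, step_eq, h]

theorem Halted.next_eq {M : DTM α b} {w : List α} {c : M.Cfg} (h : M.Halted w c) :
    M.next w c = c := by
  rw [next, show M.step w c = none from h, Option.getD_none]

theorem run_eq_iterate (M : DTM α b) (w : List α) (t : ℕ) :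
    M.run w t = (M.next w)^[t] M.init := by
  induction t with
  | zero => rfl
  | succ t ih => rw [Function.iterate_succ_apply', ← ih]; rfl

/-- `d` is reached from `c` after at most `n` steps. -/
def Reach (M : DTM α b) (w : List α) (n : ℕ) (c d : M.Cfg) : Prop :=
  ∃ s ≤ n, (M.next w)^[s] c = d

section Reach

variable {M : DTM α b} {w : List α} {n m : ℕ} {c d e : M.Cfg}

theorem Reach.refl (M : DTM α b) (w : List α) (n : ℕ) (c : M.Cfg) : M.Reach w n c c :=
  ⟨0, n.zero_le, rfl⟩

theorem Reach.mono (h : M.Reach w n c d) (hnm : n ≤ m) : M.Reach w m c d :=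
  let ⟨s, hs, e⟩ := h
  ⟨s, hs.trans hnm, e⟩

theorem Reach.trans (h : M.Reach w n c d) (h' : M.Reach w m d e) : M.Reach w (n + m) c e := by
  obtain ⟨s, hs, rfl⟩ := h
  obtain ⟨t, ht, rfl⟩ := h'
  exact ⟨t + s, by omega, Function.iterate_add_apply _ _ _ _⟩

theorem Reach.of_instr {r} (h : M.instr w c = some r) : M.Reach w 1 c (M.after w c r) :=
  ⟨1, le_rfl, next_of_instr h⟩

theorem Reach.cons {r} (h : M.instr w c = some r) (h' : M.Reach w n (M.after w c r) d) :
    M.Reach w (n + 1) c d :=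
  ((Reach.of_instr h).trans h').mono (by omega)

theorem Halted.iterate_eq (h : M.Halted w c) (t : ℕ) : (M.next w)^[t] c = c :=
  Function.iterate_fixed h.next_eq t

theorem Reach.run_eq (h : M.Reach w n M.init d) (hd : M.Halted w d) {t : ℕ} (ht : n ≤ t) :
    M.run w t = d := by
  obtain ⟨s, hs, rfl⟩ := h
  rw [run_eq_iterate, show t = (t - s) + s by omega, Function.iterate_add_apply,
    hd.iterate_eq]

theorem Reach.eq_of_halted (h : M.Reach w n c d) (hd : M.Halted w d) (h' : M.Reach w m c e)
    (he : M.Halted w e) : d = e := by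
  obtain ⟨s, hs, rfl⟩ := h
  obtain ⟨t, ht, rfl⟩ := h'
  rw [← hd.iterate_eq t, ← he.iterate_eq s, ← Function.iterate_add_apply,
    ← Function.iterate_add_apply, add_comm]

theorem reach_run (M : DTM α b) (w : List α) (t : ℕ) : M.Reach w t M.init (M.run w t) :=
  ⟨t, le_rfl, (run_eq_iterate M w t).symm⟩

/-- A step-by-step simulation transports runs. -/
theorem Reach.simulate {N : DTM β b'} {x : List β} {R : M.Cfg → N.Cfg → Prop}
    (h : ∀ c d r, R c d → M.instr w c = some r →
      ∃ r', N.instr x d = some r' ∧ R (M.after w c r) (N.after x d r'))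
    (hr : M.Reach w n c d) {c' : N.Cfg} (hc : R c c') : ∃ d', N.Reach x n c' d' ∧ R d d' := by
  obtain ⟨s, hs, rfl⟩ := hr
  suffices ∃ d', N.Reach x s c' d' ∧ R ((M.next w)^[s] c) d' by
    obtain ⟨d', h1, h2⟩ := this
    exact ⟨d', h1.mono hs, h2⟩
  clear hs
  induction s with
  | zero => exact ⟨c', Reach.refl _ _ _ _, hc⟩
  | succ s ih =>
    obtain ⟨d', h1, h2⟩ := ih
    rw [Function.iterate_succ_apply']
    cases hi : M.instr w ((M.next w)^[s] c) with
    | none => exact ⟨d', h1.mono (by omega), by rwa [Halted.next_eq (halted_iff.2 hi)]⟩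
    | some r =>
      obtain ⟨r', h3, h4⟩ := h _ _ _ h2 hi
      exact ⟨_, h1.trans (Reach.of_instr h3), by rwa [next_of_instr hi]⟩

end Reach

theorem HaltsWithin.mono {M : DTM α b} {T T' : ℕ → ℕ} (h : M.HaltsWithin T)
    (hT : ∀ n, T n ≤ T' n) : M.HaltsWithin T' := fun w => by
  have := (M.reach_run w (T w.length)).run_eq (h w) (hT w.length)
  rw [this]
  exact h w

theorem haltsWithin_of_reach {M : DTM α b} {T : ℕ → ℕ}
    (h : ∀ w, ∃ d, M.Reach w (T w.length) M.init d ∧ M.Halted w d) : M.HaltsWithin T :=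
  fun w => by
    obtain ⟨d, h1, h2⟩ := h w
    rw [h1.run_eq h2 le_rfl]
    exact h2

theorem mem_language_iff {M : DTM α b} {w : List α} {n : ℕ} {d : M.Cfg}
    (h : M.Reach w n M.init d) (hd : M.Halted w d) : w ∈ M.language ↔ d.state ∈ M.accept := by
  constructor
  · rintro ⟨t, ht, ha⟩
    rwa [(M.reach_run w t).eq_of_halted ht h hd] at ha
  · intro ha
    exact ⟨n, by rwa [h.run_eq hd le_rfl], by rwa [h.run_eq hd le_rfl]⟩

/-! ### Running times up to constant factors -/

/-- The summand `1` lets a single constant absorb finitely many lengths even where `f` vanishes;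
since `n ≤ f n`, that can only be at `0`. -/
theorem hasTime_iff {M : DTM α b} {f : ℕ → ℕ} (hf : ∀ n, n ≤ f n) :
    M.HasTime f ↔ ∃ C, M.HaltsWithin fun n => C * (f n + 1) := by
  constructor
  · rintro ⟨T, hO, hT⟩
    obtain ⟨c, hc⟩ := hO.bound
    obtain ⟨N, hN⟩ := eventually_atTop.1 hc
    -- `⌈c⌉₊` serves the lengths from `N` on, the sum serves the lengths below `N`.
    refine ⟨⌈c⌉₊ + ∑ n ∈ Finset.range N, T n, hT.mono fun n => ?_⟩
    rcases Nat.lt_or_ge n N with h | h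
    · have := Finset.single_le_sum (f := T) (fun i _ => Nat.zero_le _) (Finset.mem_range.2 h)
      nlinarith
    · have h1 := hN n h
      rw [Real.norm_natCast, Real.norm_natCast] at h1
      have h2 : (T n : ℝ) ≤ ((⌈c⌉₊ * f n : ℕ) : ℝ) := by
        push_cast
        exact h1.trans (mul_le_mul_of_nonneg_right (Nat.le_ceil c) (Nat.cast_nonneg _))
      have h3 : T n ≤ ⌈c⌉₊ * f n := by exact_mod_cast h2
      nlinarith [Nat.zero_le (∑ n ∈ Finset.range N, T n)]
  · rintro ⟨C, hC⟩
    refine ⟨_, IsBigO.of_bound (2 * C) (eventually_atTop.2 ⟨1, fun n hn => ?_⟩), hC⟩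
    rw [Real.norm_natCast, Real.norm_natCast]
    have := hf n
    have : C * (f n + 1) ≤ 2 * C * f n := by nlinarith
    exact_mod_cast this

end DTM

/-! ### Counting the symbols of a tape -/

open Classical in
/-- The change of the number of symbols `s` on a tape when `x` is replaced by `y`. -/
noncomputable def countMove {Γ : Type} (s x y : Γ) : Move :=
  if x = s then (if y = s then Move.stay else Move.left)
  else if y = s then Move.right else Move.stay

theorem finite_update {Γ : Type} {s : Γ} {t : ℤ → Γ} (h : {z | t z = s}.Finite) (p : ℤ) (y : Γ) :
    {z | Function.update t p y z = s}.Finite := by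
  refine (h.insert p).subset fun z hz => ?_
  by_cases hzp : z = p
  · exact Or.inl hzp
  · right
    simpa [Function.update_of_ne hzp] using hz

/-- Only one cell changes, so the count changes by at most one: a head can keep track of it in real
time. -/
theorem ncard_update {Γ : Type} {s : Γ} {t : ℤ → Γ} (h : {z | t z = s}.Finite) (p : ℤ) (y : Γ) :
    (({z | Function.update t p y z = s}.ncard : ℕ) : ℤ) =
      moveWork ({z | t z = s}.ncard : ℕ) (countMove s (t p) y) := by
  by_cases hy : y = s
  · have e : {z | Function.update t p y z = s} = insert p {z | t z = s} := by
      ext z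
      by_cases hzp : z = p <;> simp [Function.update_apply, hzp, hy]
    rw [e]
    by_cases hx : t p = s
    · rw [Set.insert_eq_of_mem (show p ∈ {z | t z = s} from hx)]
      simp [countMove, hx, hy, moveWork]
    · rw [Set.ncard_insert_of_notMem (show p ∉ {z | t z = s} from hx) h]
      simp [countMove, hx, hy, moveWork]
  · have e : {z | Function.update t p y z = s} = {z | t z = s} \ {p} := by
      ext z
      by_cases hzp : z = p <;> simp [Function.update_apply, hzp, hy]
    rw [e]
    by_cases hx : t p = s
    · have := Set.ncard_sdiff_singleton_add_one (show p ∈ {z | t z = s} from hx) h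
      simp only [countMove, hx, hy, moveWork, if_true, if_false]
      omega
    · rw [Set.sdiff_singleton_eq_self (show p ∉ {z | t z = s} from hx)]
      simp [countMove, hx, hy, moveWork]

theorem Inscription.ncard_eq {Γ : Type} {blank s : Γ} {m : ℕ} {t : ℤ → Γ}
    (h : Inscription blank s m t) (hs : s ≠ blank) : {z | t z = s}.ncard = m := by
  obtain ⟨p, hp⟩ := h
  have e : {z | t z = s} = ((Finset.Ico p (p + m) : Finset ℤ) : Set ℤ) := by
    ext z
    simp only [Set.mem_ofPred_eq, Finset.coe_Ico, Set.mem_Ico]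
    refine ⟨fun hz => ?_, (hp z).1⟩
    by_contra hc
    exact hs (hz.symm.trans ((hp z).2 hc))
  rw [e, Set.ncard_coe_finset]
  simp

namespace DTM

/-- The machine `C` with an additional tape whose head is at the position that equals the number
of symbols `one` on tape `i`. -/
noncomputable abbrev counting (C : DTM α b) (i : Fin b) (one : C.Sym) : DTM α (b + 1) where
  State := C.State
  Sym := C.Sym
  finState := C.finState
  finSym := C.finSym
  blank := C.blank
  start := C.start
  accept := C.accept
  trans q x s := (C.trans q x fun j => s j.castSucc).map fun r =>
    (r.1, r.2.1, Fin.snoc (α := fun _ => C.Sym × Move) r.2.2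
      (s (Fin.last b), countMove one (s i.castSucc) (r.2.2 i).1))

/-- The counting machine is in step with the original one. -/
structure CountingRel (C : DTM α b) (i : Fin b) (one : C.Sym) (c : C.Cfg)
    (d : (C.counting i one).Cfg) : Prop where
  state : d.state = c.state
  inHead : d.inHead = c.inHead
  head : ∀ j : Fin b, d.head j.castSucc = c.head j
  tape : ∀ j : Fin b, d.tape j.castSucc = c.tape j
  finite : {z | c.tape i z = one}.Finite
  count : d.head (Fin.last b) = ({z | c.tape i z = one}.ncard : ℕ)

/-- Stated for the whole `Option`, so that it transfers halting as well as steps. -/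
theorem CountingRel.instr {C : DTM α b} {i : Fin b} {one : C.Sym} {c : C.Cfg}
    {d : (C.counting i one).Cfg} (h : CountingRel C i one c d) (w : List α) :
    (C.counting i one).instr w d = (C.instr w c).map fun r =>
      (r.1, r.2.1, Fin.snoc (α := fun _ => C.Sym × Move) r.2.2
        (d.tape (Fin.last b) (d.head (Fin.last b)),
          countMove one (c.tape i (c.head i)) (r.2.2 i).1)) := by
  simp only [DTM.instr, counting, h.state, h.inHead, h.head, h.tape]

theorem CountingRel.after {C : DTM α b} {i : Fin b} {one : C.Sym} {c : C.Cfg}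
    {d : (C.counting i one).Cfg} {w : List α} {r} (h : CountingRel C i one c d)
    (hr : C.instr w c = some r) :
    ∃ r', (C.counting i one).instr w d = some r' ∧
      CountingRel C i one (C.after w c r) ((C.counting i one).after w d r') := by
  rw [h.instr, hr]
  refine ⟨_, rfl, rfl, ?_, fun j => ?_, fun j => ?_, finite_update h.finite _ _, ?_⟩
  · simp [DTM.after, h.inHead]
  · simp [DTM.after, h.head]
  · simp [DTM.after, h.head, h.tape]
  · simp only [DTM.after, Fin.snoc_last, h.count]
    exact (ncard_update h.finite _ _).symm

/-- A machine constructing `g` may be assumed to halt with a head at position `g |w|`. -/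
theorem counting_spec {C : DTM α b} {i : Fin b} {one : C.Sym} (hone : one ≠ C.blank) {T g : ℕ → ℕ}
    (hT : C.HaltsWithin T)
    (hC : ∀ w t, C.Halted w (C.run w t) → Inscription C.blank one (g w.length) ((C.run w t).tape i))
    (w : List α) :
    ∃ d, (C.counting i one).Reach w (T w.length) (C.counting i one).init d ∧
      (C.counting i one).Halted w d ∧ d.head (Fin.last b) = g w.length := by
  have e : {z : ℤ | C.init.tape i z = one} = ∅ := by
    ext z
    simpa [DTM.init] using hone.symm
  have h0 : CountingRel C i one C.init (C.counting i one).init :=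
    ⟨rfl, rfl, fun _ => rfl, fun _ => rfl, by rw [e]; exact Set.finite_empty,
      by rw [e]; simp [DTM.init]⟩
  obtain ⟨d, h1, h2⟩ := Reach.simulate (fun _ _ _ h hr => h.after hr)
    (C.reach_run w (T w.length)) h0
  refine ⟨d, h1, ?_, ?_⟩
  · rw [halted_iff, h2.instr, halted_iff.1 (hT w), Option.map_none]
  · rw [h2.count, (hC w _ (hT w)).ncard_eq hone]

end DTM

end TapeTime

namespace TapeTime

variable {α β : Type} {b b' b₁ b₂ K : ℕ}

theorem update_proj {Γ Δ : Type} (π : Γ → Δ) {t : ℤ → Γ} {p : ℤ} {a : Γ} (h : π a = π (t p))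
    (z : ℤ) : π (Function.update t p a z) = π (t z) := by
  by_cases hz : z = p
  · subst hz; simpa using h
  · rw [Function.update_of_ne hz]

theorem update_track {Γ Δ : Type} (π : Γ → Δ) {t : ℤ → Γ} {u : ℤ → Δ} {o p : ℤ} {a : Γ}
    (h : ∀ z, π (t (z + o)) = u z) (z : ℤ) :
    π (Function.update t (p + o) a (z + o)) = Function.update u p (π a) z := by
  by_cases hz : z = p
  · subst hz; simp
  · rw [Function.update_of_ne hz, Function.update_of_ne (by omega), h]

namespace DTM

/-- On every input `x`, the machine `Q` halts after at most `T x` steps. It accepts if and only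
if `x ∈ S`, and then it leaves the word `v x` (with end markers) on tape `l`, in the coding `rd`
and with the head on the left marker. -/
def Prepares (Q : DTM β b) (l : Fin b) (rd : Q.Sym → InSym α) (v : List β → List α)
    (S : Set (List β)) (T : List β → ℕ) : Prop :=
  ∀ x, ∃ d, Q.Reach x (T x) Q.init d ∧ Q.Halted x d ∧
    ((d.state ∈ Q.accept ∧ x ∈ S ∧ d.head l = 0 ∧
      ∀ p : ℕ, p ≤ (v x).length + 1 → rd (d.tape l p) = inputAt (v x) p) ∨
    (d.state ∉ Q.accept ∧ x ∉ S))

/-! ### Sequential composition -/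

section SeqComp

variable {Γ Δ : Type}

/-- Actions on the first track of the tapes in the range of `e`. -/
noncomputable def fstAct (e : Fin b → Fin K) (r : Fin b → Γ × Move) (s : Fin K → Γ × Δ) :
    Fin K → (Γ × Δ) × Move :=
  Function.extend e (fun i => (((r i).1, (s (e i)).2), (r i).2)) fun j => (s j, Move.stay)

/-- Actions on the second track of the tapes in the range of `e`, and a movement of the head of
tape `l`. -/
noncomputable def sndAct (e : Fin b → Fin K) (l : Fin K) (m : Move) (r : Fin b → Δ × Move)
    (s : Fin K → Γ × Δ) : Fin K → (Γ × Δ) × Move := fun j =>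
  if j = l then (s j, m) else
    Function.extend e (fun i => (((s (e i)).1, (r i).1), (r i).2)) (fun j => (s j, Move.stay)) j

theorem fstAct_apply {e : Fin b → Fin K} (he : Function.Injective e) (r : Fin b → Γ × Move)
    (s : Fin K → Γ × Δ) (i : Fin b) :
    fstAct e r s (e i) = (((r i).1, (s (e i)).2), (r i).2) := he.extend_apply _ _ _

theorem fstAct_snd {e : Fin b → Fin K} (he : Function.Injective e) (r : Fin b → Γ × Move)
    (s : Fin K → Γ × Δ) (j : Fin K) : (fstAct e r s j).1.2 = (s j).2 := by
  by_cases h : ∃ i, e i = j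
  · obtain ⟨i, rfl⟩ := h
    rw [fstAct_apply he]
  · rw [fstAct, Function.extend_apply' _ _ _ h]

theorem sndAct_self (e : Fin b → Fin K) (l : Fin K) (m : Move) (r : Fin b → Δ × Move)
    (s : Fin K → Γ × Δ) : sndAct e l m r s l = (s l, m) := if_pos rfl

theorem sndAct_apply {e : Fin b → Fin K} (he : Function.Injective e) {l : Fin K}
    (hl : ∀ i, e i ≠ l) (m : Move) (r : Fin b → Δ × Move) (s : Fin K → Γ × Δ) (i : Fin b) :
    sndAct e l m r s (e i) = (((s (e i)).1, (r i).1), (r i).2) := by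
  rw [sndAct, if_neg (hl i), he.extend_apply]

open Classical in
/-- The machine that runs `Q` and, if `Q` accepts, then runs `M` on the word that `Q` has prepared
on tape `l`. The two machines use different tracks of `K` common tapes. -/
noncomputable abbrev seqComp (Q : DTM β b₁) (M : DTM α b₂) (l : Fin b₁) (rd : Q.Sym → InSym α)
    (e₁ : Fin b₁ → Fin K) (e₂ : Fin b₂ → Fin K) : DTM β K where
  State := Q.State ⊕ M.State
  Sym := Q.Sym × M.Sym
  finState := by
    have := Q.finState
    have := M.finState
    infer_instance
  finSym := by
    have := Q.finSym
    have := M.finSym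
    infer_instance
  blank := (Q.blank, M.blank)
  start := Sum.inl Q.start
  accept := Sum.inr '' M.accept
  trans q x s :=
    match q with
    | Sum.inl q =>
      match Q.trans q x fun i => (s (e₁ i)).1 with
      | some r => some (Sum.inl r.1, r.2.1, fstAct e₁ r.2.2 s)
      | none =>
        if q ∈ Q.accept then some (Sum.inr M.start, Move.stay, fun j => (s j, Move.stay))
        else none
    | Sum.inr q =>
      (M.trans q (rd (s (e₁ l)).1) fun i => (s (e₂ i)).2).map fun r =>
        (Sum.inr r.1, Move.stay, sndAct e₂ (e₁ l) (clamp (rd (s (e₁ l)).1) r.2.1) r.2.2 s)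

variable {Q : DTM β b₁} {M : DTM α b₂} {l : Fin b₁} {rd : Q.Sym → InSym α}
  {e₁ : Fin b₁ → Fin K} {e₂ : Fin b₂ → Fin K}

/-- The composition is in step with the first machine. -/
structure SeqFstRel (Q : DTM β b₁) (M : DTM α b₂) (l : Fin b₁) (rd : Q.Sym → InSym α)
    (e₁ : Fin b₁ → Fin K) (e₂ : Fin b₂ → Fin K) (c : Q.Cfg)
    (d : (seqComp Q M l rd e₁ e₂).Cfg) : Prop where
  state : d.state = Sum.inl c.state
  inHead : d.inHead = c.inHead
  head : ∀ i, d.head (e₁ i) = c.head i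
  tape : ∀ i z, (d.tape (e₁ i) z).1 = c.tape i z
  blank : ∀ j z, (d.tape j z).2 = M.blank

/-- The composition is in step with the second machine, whose tape `i` is shifted by `o i` and
whose input tape is tape `l` of the first machine, with inscription `V`. -/
structure SeqSndRel (Q : DTM β b₁) (M : DTM α b₂) (l : Fin b₁) (rd : Q.Sym → InSym α)
    (e₁ : Fin b₁ → Fin K) (e₂ : Fin b₂ → Fin K) (o : Fin b₂ → ℤ) (V : ℤ → Q.Sym) (n : ℕ)
    (c : M.Cfg) (d : (seqComp Q M l rd e₁ e₂).Cfg) : Prop where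
  state : d.state = Sum.inr c.state
  inHead : d.head (e₁ l) = c.inHead
  inHead_le : c.inHead ≤ n + 1
  input : ∀ z, (d.tape (e₁ l) z).1 = V z
  head : ∀ i, d.head (e₂ i) = c.head i + o i
  tape : ∀ i z, (d.tape (e₂ i) (z + o i)).2 = c.tape i z

theorem SeqFstRel.after (he : Function.Injective e₁) {c : Q.Cfg}
    {d : (seqComp Q M l rd e₁ e₂).Cfg} {x : List β} {r} (h : SeqFstRel Q M l rd e₁ e₂ c d)
    (hr : Q.instr x c = some r) :
    ∃ r', (seqComp Q M l rd e₁ e₂).instr x d = some r' ∧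
      SeqFstRel Q M l rd e₁ e₂ (Q.after x c r) ((seqComp Q M l rd e₁ e₂).after x d r') := by
  have hi : (seqComp Q M l rd e₁ e₂).instr x d = some (Sum.inl r.1, r.2.1,
      fstAct e₁ r.2.2 fun j => d.tape j (d.head j)) := by
    simp only [DTM.instr] at hr
    simp only [DTM.instr, seqComp, h.state, h.inHead, h.head, h.tape, hr]
  refine ⟨_, hi, rfl, ?_, fun i => ?_, fun i z => ?_, fun j z => ?_⟩
  · simp only [DTM.after, h.inHead]
  · simp only [DTM.after, fstAct_apply he, h.head]
  · have := update_track (Prod.fst : Q.Sym × M.Sym → Q.Sym) (t := d.tape (e₁ i)) (u := c.tape i)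
      (o := 0) (p := c.head i) (a := ((r.2.2 i).1, (d.tape (e₁ i) (d.head (e₁ i))).2))
      (by simpa using h.tape i) z
    simp only [add_zero] at this
    simp only [DTM.after, fstAct_apply he]
    rw [h.head] at this ⊢
    exact this
  · exact (update_proj (Prod.snd : Q.Sym × M.Sym → M.Sym)
      (fstAct_snd he _ (fun j => d.tape j (d.head j)) j) z).trans (h.blank j z)

/-- The bound on `p` in `hV` is enough because the clamped head never leaves the cells from marker
to marker. -/
theorem SeqSndRel.instr {o : Fin b₂ → ℤ} {V : ℤ → Q.Sym} {v : List α}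
    (hV : ∀ p : ℕ, p ≤ v.length + 1 → rd (V p) = inputAt v p) {c : M.Cfg}
    {d : (seqComp Q M l rd e₁ e₂).Cfg} (h : SeqSndRel Q M l rd e₁ e₂ o V v.length c d)
    (x : List β) : (seqComp Q M l rd e₁ e₂).instr x d = (M.instr v c).map fun r =>
      (Sum.inr r.1, Move.stay, sndAct e₂ (e₁ l) (clamp (inputAt v c.inHead) r.2.1) r.2.2
        fun j => d.tape j (d.head j)) := by
  have h1 : rd (d.tape (e₁ l) (d.head (e₁ l))).1 = inputAt v c.inHead := by
    rw [h.input, h.inHead, hV _ h.inHead_le]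
  have h2 : ∀ i, (d.tape (e₂ i) (d.head (e₂ i))).2 = c.tape i (c.head i) := fun i => by
    rw [h.head, h.tape]
  simp only [DTM.instr, seqComp, h.state, h1, h2]

theorem SeqSndRel.after (he : Function.Injective e₂) (hl : ∀ i, e₂ i ≠ e₁ l) {o : Fin b₂ → ℤ}
    {V : ℤ → Q.Sym} {v : List α} (hV : ∀ p : ℕ, p ≤ v.length + 1 → rd (V p) = inputAt v p)
    {c : M.Cfg} {d : (seqComp Q M l rd e₁ e₂).Cfg} {x : List β} {r}
    (h : SeqSndRel Q M l rd e₁ e₂ o V v.length c d) (hr : M.instr v c = some r) :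
    ∃ r', (seqComp Q M l rd e₁ e₂).instr x d = some r' ∧
      SeqSndRel Q M l rd e₁ e₂ o V v.length (M.after v c r)
        ((seqComp Q M l rd e₁ e₂).after x d r') := by
  rw [h.instr hV, hr]
  refine ⟨_, rfl, rfl, ?_, moveInput_le h.inHead_le _, fun z => ?_, fun i => ?_, fun i z => ?_⟩
  · simp only [DTM.after, sndAct_self, h.inHead]
    exact moveWork_clamp v h.inHead_le _
  · refine (update_proj (Prod.fst : Q.Sym × M.Sym → Q.Sym) ?_ z).trans (h.input z)
    exact congrArg (fun a => a.1.1) (sndAct_self e₂ (e₁ l) _ _ fun j => d.tape j (d.head j))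
  · simp only [DTM.after, sndAct_apply he hl, h.head, moveWork_add]
  · have := update_track (Prod.snd : Q.Sym × M.Sym → M.Sym) (t := d.tape (e₂ i)) (u := c.tape i)
      (o := o i) (p := c.head i) (a := ((d.tape (e₂ i) (d.head (e₂ i))).1, (r.2.2 i).1))
      (h.tape i) z
    simp only [DTM.after, sndAct_apply he hl]
    rw [h.head] at this ⊢
    exact this

/-- The composition decides whether `x ∈ S` and `v x` is accepted by `M`. -/
theorem seqComp_spec (he₁ : Function.Injective e₁) (he₂ : Function.Injective e₂)
    (hl : ∀ i, e₂ i ≠ e₁ l) {v : List β → List α} {S : Set (List β)} {T : List β → ℕ}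
    (hQ : Q.Prepares l rd v S T) {TM : ℕ → ℕ} (hM : M.HaltsWithin TM) (x : List β) :
    (x ∈ S → ∃ d, (seqComp Q M l rd e₁ e₂).Reach x (T x + (TM (v x).length + 1))
      (seqComp Q M l rd e₁ e₂).init d ∧ (seqComp Q M l rd e₁ e₂).Halted x d ∧
      (d.state ∈ (seqComp Q M l rd e₁ e₂).accept ↔ v x ∈ M.language)) ∧
    (x ∉ S → ∃ d, (seqComp Q M l rd e₁ e₂).Reach x (T x)
      (seqComp Q M l rd e₁ e₂).init d ∧ (seqComp Q M l rd e₁ e₂).Halted x d ∧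
      d.state ∉ (seqComp Q M l rd e₁ e₂).accept) := by
  obtain ⟨c, hc, hch, hcase⟩ := hQ x
  have h0 : SeqFstRel Q M l rd e₁ e₂ Q.init (seqComp Q M l rd e₁ e₂).init :=
    ⟨rfl, rfl, fun _ => rfl, fun _ _ => rfl, fun _ _ => rfl⟩
  obtain ⟨d, hd, hR⟩ := Reach.simulate (fun _ _ _ h hr => h.after he₁ hr) hc h0
  have hi : Q.trans c.state (inputAt x c.inHead) (fun i => c.tape i (c.head i)) = none :=
    halted_iff.1 hch
  rcases hcase with ⟨ha, hS, hhead, hV⟩ | ⟨ha, hS⟩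
  · refine ⟨fun _ => ?_, fun h => absurd hS h⟩
    have hi' : (seqComp Q M l rd e₁ e₂).instr x d =
        some (Sum.inr M.start, Move.stay, fun j => (d.tape j (d.head j), Move.stay)) := by
      simp only [DTM.instr, seqComp, hR.state, hR.inHead, hR.head, hR.tape, hi, if_pos ha]
    -- The second tracks are still entirely blank, so the tapes of `M` may have their origins
    -- wherever `Q` has left its heads; no rewinding is needed.
    have h1 : SeqSndRel Q M l rd e₁ e₂ (fun i => d.head (e₂ i)) (c.tape l) (v x).length M.init
        ((seqComp Q M l rd e₁ e₂).after x d
          (Sum.inr M.start, Move.stay, fun j => (d.tape j (d.head j), Move.stay))) := by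
      refine ⟨rfl, ?_, Nat.zero_le _, fun z => ?_, fun i => ?_, fun i z => ?_⟩
      · simp [DTM.after, moveWork, hR.head, hhead, DTM.init]
      · simp [DTM.after, hR.tape]
      · simp [DTM.after, moveWork, DTM.init]
      · simp [DTM.after, hR.blank, DTM.init]
    obtain ⟨d', hd', hR'⟩ := Reach.simulate (fun _ _ _ h hr => h.after (x := x) he₂ hl hV hr)
      (M.reach_run (v x) (TM (v x).length)) h1
    refine ⟨d', (hd.trans ((Reach.of_instr hi').trans hd')).mono (by omega), ?_, ?_⟩
    · rw [halted_iff, hR'.instr hV, halted_iff.1 (hM (v x)), Option.map_none]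
    · rw [mem_language_iff (M.reach_run _ _) (hM (v x)), hR'.state]
      exact Sum.inr_injective.mem_set_image
  · refine ⟨fun h => absurd h hS, fun _ => ⟨d, hd, ?_, ?_⟩⟩
    · rw [halted_iff]
      simp only [DTM.instr, seqComp, hR.state, hR.inHead, hR.head, hR.tape, hi, if_neg ha]
    · rw [hR.state]
      rintro ⟨q, -, hq⟩
      cases hq

end SeqComp

end DTM

end TapeTime

/-! ### Stopping a machine by a linear clock -/

namespace TapeTime

variable {α β : Type} {b : ℕ}

/-- The states of a machine with a clock. -/
inductive ClockState (σ : Type) (c : ℕ) : Type where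
  | forth
  | back
  | dead
  | run (q : σ) (n : Fin (c + 1))

instance (σ : Type) (c : ℕ) [Finite σ] : Finite (ClockState σ c) :=
  Finite.of_surjective (α := Fin 3 ⊕ (σ × Fin (c + 1)))
    (fun
      | Sum.inl 0 => ClockState.forth
      | Sum.inl 1 => ClockState.back
      | Sum.inl 2 => ClockState.dead
      | Sum.inr p => ClockState.run p.1 p.2)
    (by
      rintro (_ | _ | _ | ⟨q, n⟩)
      · exact ⟨Sum.inl 0, rfl⟩
      · exact ⟨Sum.inl 1, rfl⟩
      · exact ⟨Sum.inl 2, rfl⟩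
      · exact ⟨Sum.inr (q, n), rfl⟩)

namespace DTM

section Clock

variable {Γ : Type}

/-- Actions on the first track of the first `b` tapes; on the last tape, the symbol `y` is
written to the second track and the head is moved according to `m`. -/
def clockAct (r : Fin b → Γ × Move) (s : Fin (b + 1) → Γ × Bool) (y : Bool) (m : Move) :
    Fin (b + 1) → (Γ × Bool) × Move :=
  Fin.snoc (α := fun _ => (Γ × Bool) × Move)
    (fun i => (((r i).1, (s i.castSucc).2), (r i).2)) (((s (Fin.last b)).1, y), m)

/-- No actions on the first `b` tapes. -/
def idle (s : Fin (b + 1) → Γ × Bool) : Fin b → Γ × Move :=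
  fun i => ((s i.castSucc).1, Move.stay)

/-- The machine `P` with a clock that stops it after about `(c + 1) * (n + 1)` steps on inputs of
length `n`: the last tape has a mark at position `0`, the distance of its head from the mark is
initially `n`, and it decreases in every `(c + 1)`-th step. -/
abbrev clock (P : DTM β b) (c : ℕ) : DTM β (b + 1) where
  State := ClockState P.State c
  Sym := P.Sym × Bool
  finState := by
    have := P.finState
    infer_instance
  finSym := by
    have := P.finSym
    infer_instance
  blank := (P.blank, false)
  start := ClockState.forth
  accept := {q | ∃ q' ∈ P.accept, ∃ n, q = ClockState.run q' n}
  trans q x s :=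
    match q with
    | ClockState.forth =>
      match x with
      | InSym.leftEnd =>
        some (ClockState.forth, Move.right, clockAct (idle s) s true Move.stay)
      | InSym.letter _ =>
        some (ClockState.forth, Move.right,
          clockAct (idle s) s (s (Fin.last b)).2 Move.left)
      | InSym.rightEnd =>
        some (ClockState.back, Move.left,
          clockAct (idle s) s (s (Fin.last b)).2 Move.stay)
    | ClockState.back =>
      match x with
      | InSym.leftEnd =>
        some (ClockState.run P.start 0, Move.stay,
          clockAct (idle s) s (s (Fin.last b)).2 Move.stay)
      | _ =>
        some (ClockState.back, Move.left,
          clockAct (idle s) s (s (Fin.last b)).2 Move.stay)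
    | ClockState.dead => none
    | ClockState.run q n =>
      match P.trans q x fun i => (s i.castSucc).1 with
      | none => none
      | some r =>
        if h : n.val < c then
          some (ClockState.run r.1 ⟨n + 1, by omega⟩, r.2.1,
            clockAct r.2.2 s (s (Fin.last b)).2 Move.stay)
        else if (s (Fin.last b)).2 then
          some (ClockState.dead, Move.stay,
            clockAct (idle s) s (s (Fin.last b)).2 Move.stay)
        else
          some (ClockState.run r.1 0, r.2.1,
            clockAct r.2.2 s (s (Fin.last b)).2 Move.right)

variable {P : DTM β b} {c : ℕ}

/-- The tapes of the machine with clock, for a configuration `e` of the original machine. -/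
structure ClockTapes (P : DTM β b) (c : ℕ) (B : ℤ → Bool) (h : ℤ) (e : P.Cfg)
    (d : (clock P c).Cfg) : Prop where
  head : ∀ i : Fin b, d.head i.castSucc = e.head i
  tape : ∀ (i : Fin b) z, (d.tape i.castSucc z).1 = e.tape i z
  clock : d.head (Fin.last b) = h
  marks : ∀ z, (d.tape (Fin.last b) z).2 = B z

/-- `ClockTapes` ignores state and input head, so `q` and `m` need not agree with `r`. This covers
all steps of the clocked machine. -/
theorem ClockTapes.after {B : ℤ → Bool} {h : ℤ} {e : P.Cfg} {d : (DTM.clock P c).Cfg}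
    (hd : ClockTapes P c B h e d) (x : List β) (r) (q : ClockState P.State c) (m : Move)
    (y : Bool) (m' : Move) :
    ClockTapes P c (Function.update B h y) (moveWork h m') (P.after x e r)
      ((DTM.clock P c).after x d (q, m, clockAct r.2.2 (fun j => d.tape j (d.head j)) y m')) := by
  refine ⟨fun i => ?_, fun i z => ?_, ?_, fun z => ?_⟩
  · simp [DTM.after, clockAct, hd.head]
  · have := update_track (Prod.fst : P.Sym × Bool → P.Sym) (t := d.tape i.castSucc)
      (u := e.tape i) (o := 0) (p := e.head i)
      (a := ((r.2.2 i).1, (d.tape i.castSucc (d.head i.castSucc)).2))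
      (by simpa using hd.tape i) z
    simp only [add_zero] at this
    simp only [DTM.after, clockAct, Fin.snoc_castSucc]
    rw [hd.head] at this ⊢
    exact this
  · simp [DTM.after, clockAct, hd.clock]
  · have := update_track (Prod.snd : P.Sym × Bool → Bool) (t := d.tape (Fin.last b))
      (u := B) (o := 0) (p := h)
      (a := ((d.tape (Fin.last b) (d.head (Fin.last b))).1, y))
      (by simpa using hd.marks) z
    simp only [add_zero] at this
    simp only [DTM.after, clockAct, Fin.snoc_last]
    rw [hd.clock] at this ⊢
    exact this

theorem ClockTapes.idle {B : ℤ → Bool} {h : ℤ} {e : P.Cfg} {d : (DTM.clock P c).Cfg}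
    (hd : ClockTapes P c B h e d) (x : List β) (q : ClockState P.State c) (m : Move)
    (y : Bool) (m' : Move) :
    ClockTapes P c (Function.update B h y) (moveWork h m') e
      ((DTM.clock P c).after x d (q, m, clockAct (DTM.idle fun j => d.tape j (d.head j))
        (fun j => d.tape j (d.head j)) y m')) := by
  -- An idle step is an instruction that rewrites the scanned symbols and keeps the heads in place.
  have h1 := hd.after x (e.state, Move.stay, DTM.idle fun j => d.tape j (d.head j)) q m y m'
  refine ⟨fun i => ?_, fun i z => ?_, h1.clock, h1.marks⟩
  · rw [h1.head]
    simp [DTM.after, DTM.idle, moveWork]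
  · rw [h1.tape]
    simp [DTM.after, DTM.idle, hd.head, hd.tape]

theorem ClockTapes.idle' {B : ℤ → Bool} {h : ℤ} {e : P.Cfg} {d : (DTM.clock P c).Cfg}
    (hd : ClockTapes P c B h e d) (x : List β) (q : ClockState P.State c) (m m' : Move) :
    ClockTapes P c B (moveWork h m') e
      ((DTM.clock P c).after x d (q, m, clockAct (DTM.idle fun j => d.tape j (d.head j))
        (fun j => d.tape j (d.head j)) (d.tape (Fin.last b) (d.head (Fin.last b))).2 m')) := by
  have := hd.idle x q m (d.tape (Fin.last b) (d.head (Fin.last b))).2 m'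
  rw [hd.marks, hd.clock] at this ⊢
  rwa [Function.update_eq_self] at this

/-- The inscription of the last tape. -/
def clockMarks : ℤ → Bool := Function.update (fun _ => false) 0 true

/-- Induction on the number `m` of letters still to be read; the clock head moves one cell left per
letter and so ends at distance `|x|` from the mark. -/
theorem clock_forth {x : List β} {e : P.Cfg} (m : ℕ) {d : (clock P c).Cfg}
    (hs : d.state = ClockState.forth) (hm : m ≤ x.length) (hp : d.inHead = x.length + 1 - m)
    (hd : ClockTapes P c clockMarks (-((x.length - m : ℕ) : ℤ)) e d) :
    ∃ d', (clock P c).Reach x (m + 1) d d' ∧ d'.state = ClockState.back ∧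
      d'.inHead = x.length ∧ ClockTapes P c clockMarks (-(x.length : ℤ)) e d' := by
  induction m generalizing d with
  | zero =>
    have hi : (clock P c).instr x d = some (ClockState.back, Move.left,
        clockAct (idle fun j => d.tape j (d.head j)) (fun j => d.tape j (d.head j))
          (d.tape (Fin.last b) (d.head (Fin.last b))).2 Move.stay) := by
      simp only [DTM.instr, clock, hs, inputAt_of_length_lt (show x.length < d.inHead by omega)]
    refine ⟨_, Reach.of_instr hi, rfl, ?_, hd.idle' x _ _ Move.stay⟩
    simp [DTM.after, moveInput, hp]
  | succ m ih =>
    obtain ⟨a, ha⟩ : ∃ a, inputAt x d.inHead = InSym.letter a := by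
      rw [hp, show x.length + 1 - (m + 1) = (x.length - (m + 1)) + 1 by omega]
      exact ⟨_, inputAt_succ_of_lt (by omega)⟩
    have hi : (clock P c).instr x d = some (ClockState.forth, Move.right,
        clockAct (idle fun j => d.tape j (d.head j)) (fun j => d.tape j (d.head j))
          (d.tape (Fin.last b) (d.head (Fin.last b))).2 Move.left) := by
      simp only [DTM.instr, clock, hs, ha]
    have h1 := hd.idle' x ClockState.forth Move.right Move.left
    have e1 : moveWork (-((x.length - (m + 1) : ℕ) : ℤ)) Move.left =
        (-((x.length - m : ℕ) : ℤ)) := by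
      simp only [moveWork]
      omega
    rw [e1] at h1
    obtain ⟨d', h2, h3⟩ := ih rfl (by omega) (by simp [DTM.after, moveInput, hp]; omega) h1
    exact ⟨d', Reach.cons hi h2, h3⟩

theorem clock_back {x : List β} {e : P.Cfg} {h : ℤ} (p : ℕ) {d : (clock P c).Cfg}
    (hs : d.state = ClockState.back) (hp : d.inHead = p) (hpx : p ≤ x.length)
    (hd : ClockTapes P c clockMarks h e d) :
    ∃ d', (clock P c).Reach x (p + 1) d d' ∧ d'.state = ClockState.run P.start 0 ∧
      d'.inHead = 0 ∧ ClockTapes P c clockMarks h e d' := by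
  induction p generalizing d with
  | zero =>
    have hi : (clock P c).instr x d = some (ClockState.run P.start 0, Move.stay,
        clockAct (idle fun j => d.tape j (d.head j)) (fun j => d.tape j (d.head j))
          (d.tape (Fin.last b) (d.head (Fin.last b))).2 Move.stay) := by
      simp only [DTM.instr, clock, hs, hp, inputAt_zero]
    refine ⟨_, Reach.of_instr hi, rfl, ?_, hd.idle' x _ _ Move.stay⟩
    simp [DTM.after, moveInput, hp]
  | succ p ih =>
    have hi : (clock P c).instr x d = some (ClockState.back, Move.left,
        clockAct (idle fun j => d.tape j (d.head j)) (fun j => d.tape j (d.head j))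
          (d.tape (Fin.last b) (d.head (Fin.last b))).2 Move.stay) := by
      simp only [DTM.instr, clock, hs, hp, inputAt_succ_of_lt (show p < x.length by omega)]
    obtain ⟨d', h2, h3⟩ := ih rfl (by simp [DTM.after, moveInput, hp]) (by omega)
      (hd.idle' x ClockState.back Move.left Move.stay)
    exact ⟨d', Reach.cons hi h2, h3⟩

/-- `F` is the time left: `c + 1` steps for each cell between the clock head and the mark, and `c -
n` for the counter in the state. Every simulated step lowers it by exactly one, and the clock
strikes only if `P` wants to continue at `F = 0`. The additional step is the passage to the dead
state. -/
theorem clock_run {x : List β} (F : ℕ) {e : P.Cfg} {d : (clock P c).Cfg} {n : Fin (c + 1)} {h : ℕ}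
    (hs : d.state = ClockState.run e.state n) (hp : d.inHead = e.inHead)
    (hd : ClockTapes P c clockMarks (-(h : ℤ)) e d) (hF : F = h * (c + 1) + (c - n)) :
    ∃ d', (clock P c).Reach x (F + 1) d d' ∧ (clock P c).Halted x d' ∧
      ((∃ e' n' h', P.Reach x F e e' ∧ P.Halted x e' ∧ d'.state = ClockState.run e'.state n' ∧
        ClockTapes P c clockMarks h' e' d') ∨
      (d'.state = ClockState.dead ∧ ¬ P.Halted x ((P.next x)^[F] e))) := by
  induction F generalizing e d n h with
  | zero =>
    cases hr : P.instr x e with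
    | none =>
      refine ⟨d, Reach.refl _ _ _ _, halted_iff.2 ?_,
        Or.inl ⟨e, n, _, Reach.refl _ _ _ _, halted_iff.2 hr, hs, hd⟩⟩
      simp only [DTM.instr] at hr
      simp only [DTM.instr, clock, hs, hp, hd.head, hd.tape, hr]
    | some r =>
      -- No time is left, so the clock head is on the mark and the counter is full.
      have hh : h = 0 := by
        rcases Nat.eq_zero_or_pos h with hh | hh
        · exact hh
        · have := Nat.mul_pos hh (Nat.succ_pos c)
          simp only [Nat.succ_eq_add_one] at this
          omega
      have hn : ¬ n.val < c := by omega
      have hm : (d.tape (Fin.last b) (d.head (Fin.last b))).2 = true := by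
        rw [hd.marks, hd.clock, hh]
        simp [clockMarks]
      have hi : (clock P c).instr x d = some (ClockState.dead, Move.stay,
          clockAct (idle fun j => d.tape j (d.head j)) (fun j => d.tape j (d.head j))
          (d.tape (Fin.last b) (d.head (Fin.last b))).2 Move.stay) := by
        have hr' := hr
        simp only [DTM.instr] at hr'
        simp only [DTM.instr, clock, hs, hp, hd.head, hd.tape, hr', dif_neg hn, hm, if_true]
      refine ⟨_, Reach.of_instr hi, halted_iff.2 rfl, Or.inr ⟨rfl, ?_⟩⟩
      rw [Function.iterate_zero_apply, halted_iff, hr]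
      simp
  | succ F ih =>
    cases hr : P.instr x e with
    | none =>
      refine ⟨d, Reach.refl _ _ _ _, halted_iff.2 ?_,
        Or.inl ⟨e, n, _, Reach.refl _ _ _ _, halted_iff.2 hr, hs, hd⟩⟩
      simp only [DTM.instr] at hr
      simp only [DTM.instr, clock, hs, hp, hd.head, hd.tape, hr]
    | some r =>
      suffices ∃ n' m' h', (clock P c).instr x d = some (ClockState.run r.1 n', r.2.1,
          clockAct r.2.2 (fun j => d.tape j (d.head j))
            (d.tape (Fin.last b) (d.head (Fin.last b))).2 m') ∧
          moveWork (-(h : ℤ)) m' = -((h' : ℕ) : ℤ) ∧ F = h' * (c + 1) + (c - n') by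
        obtain ⟨n', m', h', hi, hm, hF'⟩ := this
        have h1 := hd.after x r (ClockState.run r.1 n') r.2.1
          (d.tape (Fin.last b) (d.head (Fin.last b))).2 m'
        rw [hm] at h1
        have h2 : Function.update clockMarks (-(h : ℤ))
            (d.tape (Fin.last b) (d.head (Fin.last b))).2 = clockMarks := by
          rw [hd.marks, hd.clock, Function.update_eq_self]
        rw [h2] at h1
        obtain ⟨d', h3, h4, h5⟩ := ih rfl (by simp [DTM.after, hp]) h1 hF'
        refine ⟨d', Reach.cons hi h3, h4, ?_⟩
        rcases h5 with ⟨e', n'', h'', h6, h7⟩ | ⟨h6, h7⟩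
        · exact Or.inl ⟨e', n'', h'', Reach.cons hr h6, h7⟩
        · refine Or.inr ⟨h6, ?_⟩
          rwa [Function.iterate_succ_apply, next_of_instr hr]
      have hr' := hr
      simp only [DTM.instr] at hr'
      by_cases hn : n.val < c
      · refine ⟨⟨n + 1, by omega⟩, Move.stay, h, ?_, rfl, ?_⟩
        · simp only [DTM.instr, clock, hs, hp, hd.head, hd.tape, hr', dif_pos hn]
        · simp only
          omega
      · have hh : 0 < h := by
          rcases Nat.eq_zero_or_pos h with hh | hh
          · subst hh
            omega
          · exact hh
        have hm : (d.tape (Fin.last b) (d.head (Fin.last b))).2 = false := by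
          rw [hd.marks, hd.clock, clockMarks, Function.update_of_ne (by omega)]
        obtain ⟨h, rfl⟩ := Nat.exists_eq_succ_of_ne_zero hh.ne'
        -- The counter is full: it is reset, at the price of one cell of clock tape.
        refine ⟨0, Move.right, h, ?_, ?_, ?_⟩
        · simp only [DTM.instr, clock, hs, hp, hd.head, hd.tape, hr', dif_neg hn, hm]
          simp
        · simp only [moveWork]
          push_cast
          ring
        · rw [Nat.succ_mul] at hF
          simp only [Fin.val_zero]
          omega

/-- The time bound is assumed on `S` only, but results for all inputs: a machine stopped by the
clock has exceeded the bound valid on `S`, so rejection is correct. -/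
theorem Prepares.clock {l : Fin b} {rd : P.Sym → InSym α} {v : List β → List α}
    {S : Set (List β)} {T : List β → ℕ} (hP : P.Prepares l rd v S T)
    (hT : ∀ x ∈ S, T x ≤ c * (x.length + 1)) :
    (DTM.clock P c).Prepares l.castSucc (fun s => rd s.1) v S
      fun x => (c + 5) * (x.length + 1) := by
  intro x
  have hi : (DTM.clock P c).instr x (DTM.clock P c).init = some (ClockState.forth, Move.right,
      clockAct (DTM.idle fun _ => (P.blank, false)) (fun _ => (P.blank, false)) true
        Move.stay) := rfl
  have h0 : ClockTapes P c (fun _ => false) 0 P.init (DTM.clock P c).init :=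
    ⟨fun _ => rfl, fun _ _ => rfl, rfl, fun _ => rfl⟩
  have h1 := h0.idle x ClockState.forth Move.right true Move.stay
  obtain ⟨d₁, hr₁, hs₁, hp₁, hd₁⟩ := clock_forth (x := x) x.length
    (d := (DTM.clock P c).after x (DTM.clock P c).init (ClockState.forth, Move.right,
      clockAct (DTM.idle fun _ => (P.blank, false)) (fun _ => (P.blank, false)) true Move.stay))
    rfl le_rfl
    (by simp [DTM.after, DTM.init, moveInput]) (by rw [Nat.sub_self]; exact h1)
  obtain ⟨d₂, hr₂, hs₂, hp₂, hd₂⟩ := clock_back x.length hs₁ hp₁ le_rfl hd₁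
  obtain ⟨d₃, hr₃, hh₃, hcase⟩ := clock_run (x := x) _ hs₂ hp₂ hd₂ rfl
  refine ⟨d₃, ((Reach.cons hi hr₁).trans (hr₂.trans hr₃)).mono ?_, hh₃, ?_⟩
  · simp only [Fin.val_zero, Nat.sub_zero]
    nlinarith
  obtain ⟨e, he, heh, hes⟩ := hP x
  rcases hcase with ⟨e', n, h', hre', hhe', hse', hte'⟩ | ⟨hdead, hnot⟩
  · obtain rfl := he.eq_of_halted heh hre' hhe'
    rcases hes with ⟨ha, hS, hh, hV⟩ | ⟨ha, hS⟩
    · refine Or.inl ⟨⟨_, ha, n, hse'⟩, hS, by rw [hte'.head, hh], fun p hp => ?_⟩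
      simp only [hte'.tape, hV p hp]
    · refine Or.inr ⟨?_, hS⟩
      rw [hse']
      rintro ⟨q, hq, n', hqn⟩
      cases hqn
      exact ha hq
  · refine Or.inr ⟨?_, fun hS => hnot ?_⟩
    · rw [hdead]
      rintro ⟨q, -, n', hqn⟩
      cases hqn
    · rw [← run_eq_iterate, he.run_eq heh]
      · exact heh
      · have := hT x hS
        simp only [Fin.val_zero, Nat.sub_zero]
        nlinarith

end Clock

end DTM

end TapeTime

namespace TapeTime

variable {α β γ : Type} {b : ℕ}

instance [Finite α] : Finite (InSym α) :=
  Finite.of_surjective (α := Option (Option α))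
    (fun
      | none => InSym.leftEnd
      | some none => InSym.rightEnd
      | some (some a) => InSym.letter a)
    (by
      rintro (_ | a | _)
      · exact ⟨none, rfl⟩
      · exact ⟨some (some a), rfl⟩
      · exact ⟨some none, rfl⟩)

/-! ### Padded words -/

/-- Translation of input symbols, where letters without a translation are read as end marker. -/
def decodeSym (dec : α → Option β) : InSym α → InSym β
  | InSym.leftEnd => InSym.leftEnd
  | InSym.letter a => (dec a).elim InSym.rightEnd InSym.letter
  | InSym.rightEnd => InSym.rightEnd

/-- Translation of the longest prefix of a word that consists of letters with a translation. -/
def unpad (dec : α → Option β) : List α → List β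
  | [] => []
  | a :: w => (dec a).elim [] fun c => c :: unpad dec w

theorem length_unpad_le (dec : α → Option β) (w : List α) :
    (unpad dec w).length ≤ w.length := by
  induction w with
  | nil => exact le_rfl
  | cons a w ih => cases h : dec a <;> simp [unpad, h, ih]

theorem length_unpad_map (dec : α → Option β) (h : β → γ) (w : List α) :
    (unpad (fun a => (dec a).map h) w).length = (unpad dec w).length := by
  induction w with
  | nil => rfl
  | cons a w ih => cases h : dec a <;> simp [unpad, h, ih]

theorem length_unpad_some (h : α → β) (w : List α) :
    (unpad (fun a => some (h a)) w).length = w.length := by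
  induction w with
  | nil => rfl
  | cons a w ih => simp [unpad, ih]

theorem unpad_append_replicate {dec : α → Option β} {enc : β → α} {pad : α}
    (h : ∀ c, dec (enc c) = some c) (hpad : dec pad = none) (w : List β) (m : ℕ) :
    unpad dec (w.map enc ++ List.replicate m pad) = w := by
  induction w with
  | nil => cases m <;> simp [unpad, List.replicate_succ, hpad]
  | cons c w ih => simp [unpad, h, ih]

/-- The bound on `p` is essential: behind the first untranslatable letter, which is read as the
right marker, translatable letters may follow. -/
theorem decodeSym_inputAt (dec : α → Option β) (w : List α) {p : ℕ}
    (hp : p ≤ (unpad dec w).length + 1) :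
    decodeSym dec (inputAt w p) = inputAt (unpad dec w) p := by
  induction w generalizing p with
  | nil => cases p <;> simp [inputAt, decodeSym, unpad]
  | cons a w ih =>
    match p with
    | 0 => rfl
    | 1 => cases h : dec a <;> simp [inputAt, decodeSym, unpad, h]
    | p + 2 =>
      cases h : dec a with
      | none => simp [unpad, h] at hp
      | some c =>
        have := @ih (p + 1) (by simpa [unpad, h] using hp)
        simpa [inputAt, unpad, h] using this

/-- The left marker, the first `p - 1` letters of `x`, and a right marker at position `g + 1`. -/
def padTape (x : List β) (g : ℕ) (p : ℤ) (z : ℤ) : Option (InSym β) :=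
  if z = g + 1 then some InSym.rightEnd
  else if 0 ≤ z ∧ z < p then some (inputAt x z.toNat) else none

/-- `y` is the left marker. -/
def isLeft : Option (InSym β) → Bool
  | some InSym.leftEnd => true
  | _ => false

/-- `y` is the right marker. -/
def isRight : Option (InSym β) → Bool
  | some InSym.rightEnd => true
  | _ => false

theorem isLeft_padTape_zero (x : List β) (g : ℕ) {p : ℤ} (hp : 0 < p) :
    isLeft (padTape x g p 0) = true := by
  rw [padTape, if_neg (by omega), if_pos (by omega)]
  rfl

theorem isLeft_padTape_pos (x : List β) (g : ℕ) (p : ℤ) {z : ℤ} (hz : 0 < z) :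
    isLeft (padTape x g p z) = false := by
  unfold padTape
  split_ifs with h1 h2
  · rfl
  · obtain ⟨n, hn⟩ := Nat.exists_eq_succ_of_ne_zero (by omega : z.toNat ≠ 0)
    rw [hn, inputAt]
    cases x[n]? <;> rfl
  · rfl

theorem isRight_padTape_self (x : List β) (g : ℕ) (p : ℕ) :
    isRight (padTape x g p p) = true ↔ p = g + 1 := by
  unfold padTape
  split_ifs with h1 h2
  · simp only [isRight, true_iff]
    omega
  · omega
  · simp only [isRight, Bool.false_eq_true, false_iff]
    omega

/-- A left marker at position `0`. -/
def leftMark (β : Type) : ℤ → Option (InSym β) :=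
  Function.update (fun _ => none) 0 (some InSym.leftEnd)

theorem padTape_one (x : List β) (g : ℕ) :
    Function.update (leftMark β) ((g : ℤ) + 1) (some InSym.rightEnd) = padTape x g 1 := by
  funext z
  unfold padTape leftMark
  by_cases h1 : z = g + 1
  · simp [h1]
  · rw [Function.update_of_ne h1, if_neg h1]
    by_cases h2 : z = 0
    · simp [h2, inputAt_zero]
    · rw [Function.update_of_ne h2, if_neg (by omega)]

theorem padTape_succ (x : List β) {g p : ℕ} (hp : p ≤ g) :
    Function.update (padTape x g p) p (some (inputAt x p)) = padTape x g (p + 1 : ℕ) := by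
  funext z
  by_cases h : z = p
  · subst h
    rw [Function.update_self, padTape, if_neg (by omega), if_pos (by omega), Int.toNat_natCast]
  · rw [Function.update_of_ne h, padTape, padTape]
    by_cases h' : 0 ≤ z ∧ z < (p : ℤ)
    · rw [if_pos h', if_pos (by omega : 0 ≤ z ∧ z < ((p + 1 : ℕ) : ℤ))]
    · rw [if_neg h', if_neg (by omega : ¬ (0 ≤ z ∧ z < ((p + 1 : ℕ) : ℤ)))]

theorem padTape_length (x : List β) {p : ℕ} (hp : p ≤ x.length + 1) :
    padTape x x.length (x.length + 1 : ℕ) p = some (inputAt x p) := by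
  unfold padTape
  split_ifs with h1 h2
  · rw [inputAt_of_length_lt (by omega)]
  · rw [Int.toNat_natCast]
  · omega

/-- Reading a blank as `pad`. -/
def readPadded (enc : α → β) (pad : β) (y : Option (InSym α)) : InSym β :=
  y.elim (InSym.letter pad) (decodeSym fun a => some (enc a))

/-- The padding is never written: the blank cells between the copy of `w` and the right marker are
read as padding letters. -/
theorem readPadded_padTape (enc : α → β) (pad : β) (w : List α) {g p : ℕ} (hg : w.length ≤ g)
    (hp : p ≤ g + 1) : readPadded enc pad (padTape w g (w.length + 1 : ℕ) p) =
      inputAt (w.map enc ++ List.replicate (g - w.length) pad) p := by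
  unfold padTape
  split_ifs with h1 h2
  · rw [inputAt_of_length_lt (by simp; omega)]
    rfl
  · rw [Int.toNat_natCast]
    rcases p with _ | p
    · rfl
    · have h3 : p < w.length := by omega
      rw [inputAt_succ_of_lt h3, inputAt_succ_of_lt (by simp; omega),
        List.getElem_append_left (by simpa using h3)]
      simp [readPadded, decodeSym]
  · obtain ⟨p, rfl⟩ := Nat.exists_eq_succ_of_ne_zero (by omega : p ≠ 0)
    rw [inputAt_succ_of_lt (by simp; omega),
      List.getElem_append_right (by simp; omega)]
    simp [readPadded]

/-- The states of the machine `DTM.preparer`. -/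
inductive PrepState (σ : Type) : Type where
  | start
  | run (q : σ)
  | mark
  | back
  | copy
  | rewind
  | done

instance (σ : Type) [Finite σ] : Finite (PrepState σ) :=
  Finite.of_surjective (α := Fin 6 ⊕ σ)
    (fun
      | Sum.inl 0 => PrepState.start
      | Sum.inl 1 => PrepState.mark
      | Sum.inl 2 => PrepState.back
      | Sum.inl 3 => PrepState.copy
      | Sum.inl 4 => PrepState.rewind
      | Sum.inl 5 => PrepState.done
      | Sum.inr q => PrepState.run q)
    (by
      rintro (_ | q | _ | _ | _ | _ | _)
      · exact ⟨Sum.inl 0, rfl⟩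
      · exact ⟨Sum.inr q, rfl⟩
      · exact ⟨Sum.inl 1, rfl⟩
      · exact ⟨Sum.inl 2, rfl⟩
      · exact ⟨Sum.inl 3, rfl⟩
      · exact ⟨Sum.inl 4, rfl⟩
      · exact ⟨Sum.inl 5, rfl⟩)

/-! ### Laying out the input between markers at distance `g + 1` -/

namespace DTM

section Preparer

variable {Γ Δ : Type}

/-- Write `y` on the second track of the last tape, and move its head. -/
def lastAct (s : Fin (b + 1) → Γ × Δ) (y : Δ) (m : Move) : Fin (b + 1) → (Γ × Δ) × Move :=
  Fin.snoc (α := fun _ => (Γ × Δ) × Move) (fun i => (s i.castSucc, Move.stay))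
    (((s (Fin.last b)).1, y), m)

/-- Given a machine `C` that halts with the last head at position `g`, this machine writes its
input `x` on the last tape, with the left marker at position `0` and a right marker at position
`g + 1`. It rejects if `x` is longer than `g` and, for `exact = true`, also if `x` is shorter. -/
abbrev preparer [Finite β] (C : DTM γ (b + 1)) (dec : β → Option γ) (exact : Bool) :
    DTM β (b + 1) where
  State := PrepState C.State
  Sym := C.Sym × Option (InSym β)
  finState := by
    have := C.finState
    infer_instance
  finSym := by
    have := C.finSym
    infer_instance
  blank := (C.blank, none)
  start := PrepState.start
  accept := {PrepState.done}
  trans q x s :=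
    match q with
    | PrepState.start =>
      some (PrepState.run C.start, Move.stay, lastAct s (some InSym.leftEnd) Move.stay)
    | PrepState.run q =>
      match C.trans q (decodeSym dec x) fun j => (s j).1 with
      | some r =>
        some (PrepState.run r.1, clamp (decodeSym dec x) r.2.1,
          fun j => (((r.2.2 j).1, (s j).2), (r.2.2 j).2))
      | none => some (PrepState.mark, Move.stay, lastAct s (s (Fin.last b)).2 Move.right)
    | PrepState.mark =>
      some (PrepState.back, Move.left, lastAct s (some InSym.rightEnd) Move.left)
    | PrepState.back =>
      if isLeft (s (Fin.last b)).2 then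
        some (PrepState.copy, Move.right, lastAct s (s (Fin.last b)).2 Move.right)
      else some (PrepState.back, Move.left, lastAct s (s (Fin.last b)).2 Move.left)
    | PrepState.copy =>
      match x with
      | InSym.leftEnd => none
      | InSym.letter a =>
        if isRight (s (Fin.last b)).2 then none
        else some (PrepState.copy, Move.right, lastAct s (some (InSym.letter a)) Move.right)
      | InSym.rightEnd =>
        if exact = true ∧ ¬ isRight (s (Fin.last b)).2 = true then none
        else some (PrepState.rewind, Move.stay, lastAct s (s (Fin.last b)).2 Move.stay)
    | PrepState.rewind =>
      if isLeft (s (Fin.last b)).2 then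
        some (PrepState.done, Move.stay, lastAct s (s (Fin.last b)).2 Move.stay)
      else some (PrepState.rewind, Move.stay, lastAct s (s (Fin.last b)).2 Move.left)
    | PrepState.done => none

variable [Finite β] {C : DTM γ (b + 1)} {dec : β → Option γ} {exact : Bool}

/-- The preparer is in step with `C`. -/
structure PrepRel (C : DTM γ (b + 1)) (dec : β → Option γ) (exact : Bool) (X : ℤ → Option (InSym β))
    (n : ℕ) (c : C.Cfg) (d : (preparer C dec exact).Cfg) : Prop where
  state : d.state = PrepState.run c.state
  inHead : d.inHead = c.inHead
  inHead_le : c.inHead ≤ n + 1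
  head : ∀ j, d.head j = c.head j
  tape : ∀ j z, (d.tape j z).1 = c.tape j z
  marks : ∀ z, (d.tape (Fin.last b) z).2 = X z

theorem PrepRel.after {X : ℤ → Option (InSym β)} {c : C.Cfg} {d : (preparer C dec exact).Cfg}
    {x : List β} {r} (h : PrepRel C dec exact X (unpad dec x).length c d)
    (hr : C.instr (unpad dec x) c = some r) :
    ∃ r', (preparer C dec exact).instr x d = some r' ∧
      PrepRel C dec exact X (unpad dec x).length (C.after (unpad dec x) c r)
        ((preparer C dec exact).after x d r') := by
  have hx : decodeSym dec (inputAt x d.inHead) = inputAt (unpad dec x) c.inHead := by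
    rw [h.inHead, decodeSym_inputAt _ _ h.inHead_le]
  have hi : (preparer C dec exact).instr x d = some (PrepState.run r.1,
      clamp (inputAt (unpad dec x) c.inHead) r.2.1,
      fun j => (((r.2.2 j).1, (d.tape j (d.head j)).2), (r.2.2 j).2)) := by
    simp only [DTM.instr] at hr
    simp only [DTM.instr, preparer, h.state, hx, h.head, h.tape, hr]
  refine ⟨_, hi, rfl, ?_, moveInput_le h.inHead_le _, fun j => ?_, fun j z => ?_, fun z => ?_⟩
  · simp only [DTM.after, h.inHead]
    exact moveInput_clamp _ (length_unpad_le _ _) h.inHead_le _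
  · simp only [DTM.after, h.head]
  · have := update_track (Prod.fst : C.Sym × Option (InSym β) → C.Sym) (t := d.tape j)
      (u := c.tape j) (o := 0) (p := c.head j)
      (a := ((r.2.2 j).1, (d.tape j (d.head j)).2)) (by simpa using h.tape j) z
    simp only [add_zero] at this
    simp only [DTM.after]
    rw [h.head] at this ⊢
    exact this
  · refine (update_proj (Prod.snd : C.Sym × Option (InSym β) → Option (InSym β)) ?_ z).trans
      (h.marks z)
    rfl

/-- State and input head position, and the head position and the inscription of the last tape. -/
structure PrepAt (C : DTM γ (b + 1)) (dec : β → Option γ) (exact : Bool) (q : PrepState C.State)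
    (p : ℕ) (h : ℤ) (X : ℤ → Option (InSym β)) (d : (preparer C dec exact).Cfg) : Prop where
  state : d.state = q
  inHead : d.inHead = p
  head : d.head (Fin.last b) = h
  marks : ∀ z, (d.tape (Fin.last b) z).2 = X z

variable {q : PrepState C.State} {p : ℕ} {h : ℤ} {X : ℤ → Option (InSym β)}
  {d : (preparer C dec exact).Cfg}

theorem PrepAt.after (hd : PrepAt C dec exact q p h X d) (x : List β) (q' : PrepState C.State)
    (m : Move) (y : Option (InSym β)) (m' : Move) :
    PrepAt C dec exact q' (moveInput x.length p m) (moveWork h m') (Function.update X h y)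
      ((preparer C dec exact).after x d
        (q', m, lastAct (fun j => d.tape j (d.head j)) y m')) := by
  refine ⟨rfl, ?_, ?_, fun z => ?_⟩
  · simp only [DTM.after, hd.inHead]
  · simp [DTM.after, lastAct, hd.head]
  · have := update_track (Prod.snd : C.Sym × Option (InSym β) → _) (t := d.tape (Fin.last b))
      (u := X) (o := 0) (p := h)
      (a := ((d.tape (Fin.last b) (d.head (Fin.last b))).1, y))
      (by simpa using hd.marks) z
    simp only [add_zero] at this
    simp only [DTM.after, lastAct, Fin.snoc_last]
    rw [hd.head] at this ⊢
    exact this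

theorem PrepAt.scan (hd : PrepAt C dec exact q p h X d) :
    (d.tape (Fin.last b) (d.head (Fin.last b))).2 = X h := by
  rw [hd.marks, hd.head]

theorem PrepAt.after_same (hd : PrepAt C dec exact q p h X d) (x : List β)
    (q' : PrepState C.State) (m m' : Move) :
    PrepAt C dec exact q' (moveInput x.length p m) (moveWork h m') X
      ((preparer C dec exact).after x d
        (q', m, lastAct (fun j => d.tape j (d.head j)) (X h) m')) := by
  have := hd.after x q' m (X h) m'
  rwa [Function.update_eq_self] at this

theorem PrepAt.instr_mark (hd : PrepAt C dec exact PrepState.mark p h X d) (x : List β) :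
    (preparer C dec exact).instr x d = some (PrepState.back, Move.left,
      lastAct (fun j => d.tape j (d.head j)) (some InSym.rightEnd) Move.left) := by
  simp only [DTM.instr, preparer, hd.state]

/-- One loop rewinds both heads. As `p ≤ h`, the input head is on its left marker by the time the
work head is, and blocked moves do no harm. -/
theorem preparer_back {x : List β} {g : ℕ} (h : ℕ) (hp : p ≤ h)
    (hd : PrepAt C dec exact PrepState.back p h (padTape x g 1) d) :
    ∃ d', (preparer C dec exact).Reach x (h + 1) d d' ∧
      PrepAt C dec exact PrepState.copy 1 1 (padTape x g 1) d' := by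
  induction h generalizing p d with
  | zero =>
    obtain rfl := Nat.le_zero.1 hp
    have hi : (preparer C dec exact).instr x d = some (PrepState.copy, Move.right,
        lastAct (fun j => d.tape j (d.head j)) (padTape x g 1 (0 : ℕ)) Move.right) := by
      simp only [DTM.instr, preparer, hd.state, hd.scan, Nat.cast_zero,
        isLeft_padTape_zero x g one_pos, if_true]
    refine ⟨_, Reach.of_instr hi, ?_⟩
    simpa [moveInput, moveWork] using hd.after_same x PrepState.copy Move.right Move.right
  | succ h ih =>
    have hi : (preparer C dec exact).instr x d = some (PrepState.back, Move.left,
        lastAct (fun j => d.tape j (d.head j)) (padTape x g 1 (h + 1 : ℕ)) Move.left) := by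
      simp only [DTM.instr, preparer, hd.state, hd.scan,
        isLeft_padTape_pos x g 1 (by omega : (0 : ℤ) < (h + 1 : ℕ)), Bool.false_eq_true, if_false]
    have h1 := hd.after_same x PrepState.back Move.left Move.left
    rw [show moveWork ((h + 1 : ℕ) : ℤ) Move.left = h by simp [moveWork]] at h1
    obtain ⟨d', h2, h3⟩ := ih (by simp only [moveInput]; omega) h1
    exact ⟨d', Reach.cons hi h2, h3⟩

/-- Both heads are at `p`, and `m` is the distance to the right marker on the work tape. Which of
the two right ends is met first decides the comparison of `|x|` with `g`. -/
theorem preparer_copy {x : List β} {g : ℕ} (m : ℕ) (hp : 1 ≤ p) (hpx : p ≤ x.length + 1)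
    (hm : p + m = g + 1) (hd : PrepAt C dec exact PrepState.copy p p (padTape x g p) d) :
    ∃ d', (preparer C dec exact).Reach x (m + 1) d d' ∧
      ((PrepAt C dec exact PrepState.rewind (x.length + 1) (x.length + 1 : ℕ)
          (padTape x g (x.length + 1 : ℕ)) d' ∧ x.length ≤ g ∧ (exact = true → x.length = g)) ∨
        (d'.state = PrepState.copy ∧ (preparer C dec exact).Halted x d' ∧
          ¬ (x.length ≤ g ∧ (exact = true → x.length = g)))) := by
  induction m generalizing p d with
  | zero =>
    have hR := (isRight_padTape_self x g p).2 (by omega)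
    rcases Nat.lt_or_ge x.length p with hlt | hge
    · have hi : (preparer C dec exact).instr x d = some (PrepState.rewind, Move.stay,
          lastAct (fun j => d.tape j (d.head j)) (padTape x g p p) Move.stay) := by
        simp only [DTM.instr, preparer, hd.state, hd.inHead, hd.scan, inputAt_of_length_lt hlt,
          hR, not_true_eq_false, and_false, if_false]
      refine ⟨_, Reach.of_instr hi, Or.inl ⟨?_, by omega, fun _ => by omega⟩⟩
      have h1 := hd.after_same x PrepState.rewind Move.stay Move.stay
      obtain rfl : p = x.length + 1 := by omega
      exact h1
    · refine ⟨d, Reach.refl _ _ _ _, Or.inr ⟨hd.state, halted_iff.2 ?_, by omega⟩⟩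
      obtain ⟨k, rfl⟩ := Nat.exists_eq_succ_of_ne_zero (by omega : p ≠ 0)
      simp only [DTM.instr, preparer, hd.state, hd.inHead, hd.scan,
        inputAt_succ_of_lt (show k < x.length by omega), hR, if_true]
  | succ m ih =>
    have hR : isRight (padTape x g p p) = false := by
      rw [← Bool.not_eq_true, isRight_padTape_self]
      omega
    rcases Nat.lt_or_ge x.length p with hlt | hge
    · by_cases he : exact = true
      · refine ⟨d, Reach.refl _ _ _ _, Or.inr ⟨hd.state, halted_iff.2 ?_, ?_⟩⟩
        · simp [DTM.instr, preparer, hd.state, hd.inHead, hd.scan, inputAt_of_length_lt hlt,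
            hR, he]
        · rintro ⟨-, h⟩
          have := h he
          omega
      · have hi : (preparer C dec exact).instr x d = some (PrepState.rewind, Move.stay,
            lastAct (fun j => d.tape j (d.head j)) (padTape x g p p) Move.stay) := by
          simp only [DTM.instr, preparer, hd.state, hd.inHead, hd.scan, inputAt_of_length_lt hlt]
          exact if_neg fun h => he h.1
        refine ⟨_, (Reach.of_instr hi).mono (by omega),
          Or.inl ⟨?_, by omega, fun h => absurd h he⟩⟩
        have h1 := hd.after_same x PrepState.rewind Move.stay Move.stay
        obtain rfl : p = x.length + 1 := by omega
        exact h1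
    · obtain ⟨a, ha⟩ : ∃ a, inputAt x p = InSym.letter a := by
        obtain ⟨k, rfl⟩ := Nat.exists_eq_succ_of_ne_zero (by omega : p ≠ 0)
        exact ⟨_, inputAt_succ_of_lt hge⟩
      have hi : (preparer C dec exact).instr x d = some (PrepState.copy, Move.right,
          lastAct (fun j => d.tape j (d.head j)) (some (inputAt x p)) Move.right) := by
        simp only [DTM.instr, preparer, hd.state, hd.inHead, hd.scan, ha, hR,
          Bool.false_eq_true, if_false]
      have h1 := hd.after x PrepState.copy Move.right (some (inputAt x p)) Move.right
      rw [padTape_succ x (by omega),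
        show moveWork (p : ℤ) Move.right = (p + 1 : ℕ) by simp [moveWork],
        show moveInput x.length p Move.right = p + 1 by simp only [moveInput]; omega] at h1
      obtain ⟨d', h2, h3⟩ := ih (by omega) (by omega) (by omega) h1
      exact ⟨d', Reach.cons hi h2, h3⟩

theorem preparer_rewind {x : List β} {g : ℕ} {n : ℤ} (hn : 0 < n) (h : ℕ)
    (hd : PrepAt C dec exact PrepState.rewind p h (padTape x g n) d) :
    ∃ d', (preparer C dec exact).Reach x (h + 1) d d' ∧
      PrepAt C dec exact PrepState.done p 0 (padTape x g n) d' := by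
  induction h generalizing d with
  | zero =>
    have hi : (preparer C dec exact).instr x d = some (PrepState.done, Move.stay,
        lastAct (fun j => d.tape j (d.head j)) (padTape x g n (0 : ℕ)) Move.stay) := by
      simp only [DTM.instr, preparer, hd.state, hd.scan, Nat.cast_zero,
        isLeft_padTape_zero x g hn, if_true]
    exact ⟨_, Reach.of_instr hi, hd.after_same x PrepState.done Move.stay Move.stay⟩
  | succ h ih =>
    have hi : (preparer C dec exact).instr x d = some (PrepState.rewind, Move.stay,
        lastAct (fun j => d.tape j (d.head j)) (padTape x g n (h + 1 : ℕ)) Move.left) := by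
      simp only [DTM.instr, preparer, hd.state, hd.scan,
        isLeft_padTape_pos x g n (by omega : (0 : ℤ) < (h + 1 : ℕ)), Bool.false_eq_true, if_false]
    have h1 := hd.after_same x PrepState.rewind Move.stay Move.left
    rw [show moveWork ((h + 1 : ℕ) : ℤ) Move.left = h by simp [moveWork]] at h1
    obtain ⟨d', h2, h3⟩ := ih h1
    exact ⟨d', Reach.cons hi h2, h3⟩

/-- Besides the `n` steps of `C`, there are three single steps (left marker, end of `C`, right
marker), at most `g + 1` steps each for going back and copying, and `g + 2` for rewinding. -/
theorem preparer_spec {x : List β} {n g : ℕ} {c : C.Cfg}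
    (hc : C.Reach (unpad dec x) n C.init c) (hch : C.Halted (unpad dec x) c)
    (hcg : c.head (Fin.last b) = g) (hg : (unpad dec x).length ≤ g) :
    ∃ d, (preparer C dec exact).Reach x (n + 3 * g + 7) (preparer C dec exact).init d ∧
      (preparer C dec exact).Halted x d ∧
      ((d.state = PrepState.done ∧ (x.length ≤ g ∧ (exact = true → x.length = g)) ∧
          d.head (Fin.last b) = 0 ∧
          ∀ z, (d.tape (Fin.last b) z).2 = padTape x g (x.length + 1 : ℕ) z) ∨
        (d.state ≠ PrepState.done ∧ ¬ (x.length ≤ g ∧ (exact = true → x.length = g)))) := by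
  have hi₀ : (preparer C dec exact).instr x (preparer C dec exact).init =
      some (PrepState.run C.start, Move.stay,
        lastAct (fun _ => (C.blank, none)) (some InSym.leftEnd) Move.stay) := rfl
  have h₀ : PrepAt C dec exact PrepState.start 0 0 (fun _ => none)
      (preparer C dec exact).init := ⟨rfl, rfl, rfl, fun _ => rfl⟩
  have h₁ := h₀.after x (PrepState.run C.start) Move.stay (some InSym.leftEnd) Move.stay
  have hR₁ : PrepRel C dec exact (leftMark β)
      (unpad dec x).length C.init ((preparer C dec exact).after x (preparer C dec exact).init
        (PrepState.run C.start, Move.stay,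
          lastAct (fun _ => (C.blank, none)) (some InSym.leftEnd) Move.stay)) := by
    refine ⟨rfl, rfl, Nat.zero_le _, fun j => ?_, fun j z => ?_, h₁.marks⟩
    · induction j using Fin.lastCases <;> simp [DTM.after, lastAct, moveWork, DTM.init]
    · refine (update_proj (Prod.fst : C.Sym × Option (InSym β) → C.Sym) ?_ z).trans rfl
      induction j using Fin.lastCases <;> simp [lastAct, DTM.init]
  obtain ⟨d₂, hd₂, hR₂⟩ := Reach.simulate (fun _ _ _ h hr => h.after hr) hc hR₁
  have h₂ : PrepAt C dec exact (PrepState.run c.state) c.inHead g _ d₂ :=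
    ⟨hR₂.state, hR₂.inHead, by rw [hR₂.head, hcg], hR₂.marks⟩
  have hi₂ : (preparer C dec exact).instr x d₂ = some (PrepState.mark, Move.stay,
      lastAct (fun j => d₂.tape j (d₂.head j))
        (leftMark β g) Move.right) := by
    have hr := halted_iff.1 hch
    have hx : decodeSym dec (inputAt x d₂.inHead) = inputAt (unpad dec x) c.inHead := by
      rw [hR₂.inHead, decodeSym_inputAt _ _ hR₂.inHead_le]
    rw [← h₂.scan]
    simp only [DTM.instr] at hr
    simp only [DTM.instr, preparer, hR₂.state, hx, hR₂.head, hR₂.tape, hr]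
  have h₃ := h₂.after_same x PrepState.mark Move.stay Move.right
  have hi₃ := h₃.instr_mark x
  have h₄ := h₃.after x PrepState.back Move.left (some InSym.rightEnd) Move.left
  rw [show moveWork (g : ℤ) Move.right = g + 1 from rfl, padTape_one x,
    show moveWork ((g : ℤ) + 1) Move.left = g by simp [moveWork]] at h₄
  have hle := hR₂.inHead_le
  -- `C` leaves the input head at most at `|unpad dec x| + 1 ≤ g + 1`, and placing the right marker
  -- has already moved it one cell left.
  obtain ⟨d₅, hd₅, h₅⟩ := preparer_back g (by simp only [moveInput]; omega) h₄
  obtain ⟨d₆, hd₆, h₆⟩ := preparer_copy (p := 1) g le_rfl (by omega) (by omega) h₅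
  have hreach := (Reach.cons hi₀ hd₂).trans (Reach.cons hi₂ (Reach.cons hi₃ (hd₅.trans hd₆)))
  rcases h₆ with ⟨h₆, hgood⟩ | ⟨hs, hh, hbad⟩
  · obtain ⟨d₇, hd₇, h₇⟩ := preparer_rewind (by omega) _ h₆
    exact ⟨d₇, (hreach.trans hd₇).mono (by omega),
      halted_iff.2 (by simp only [DTM.instr, preparer, h₇.state]),
      Or.inl ⟨h₇.state, hgood, h₇.head, h₇.marks⟩⟩
  · exact ⟨d₆, hreach.mono (by omega), hh, Or.inr ⟨by rw [hs]; simp, hbad⟩⟩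

end Preparer

end DTM

end TapeTime

/-! ### The padding argument -/

namespace TapeTime

variable {α β γ : Type} {b : ℕ}

theorem IsTimeBound.le {f : ℕ → ℕ} (hf : IsTimeBound f) (n : ℕ) : n ≤ f n :=
  (hf n).1

namespace DTM

theorem language_eq_and_hasTime {N : DTM α b} {L : Language α} {f : ℕ → ℕ} {c : ℕ}
    (hf : ∀ n, n ≤ f n) (h : ∀ w, ∃ d, N.Reach w (c * (f w.length + 1)) N.init d ∧
      N.Halted w d ∧ (d.state ∈ N.accept ↔ w ∈ L)) : N.language = L ∧ N.HasTime f := by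
  refine ⟨Set.ext fun w => ?_, (hasTime_iff hf).2 ⟨c, haltsWithin_of_reach fun w => ?_⟩⟩
  · obtain ⟨d, h1, h2, h3⟩ := h w
    exact (mem_language_iff h1 h2).trans h3
  · obtain ⟨d, h1, h2, -⟩ := h w
    exact ⟨d, h1, h2⟩

/-- On every input `u`, the machine `C` halts after at most `T (g |u|)` steps with the last head
at position `g |u|`. -/
def Constructs (C : DTM γ (b + 1)) (g T : ℕ → ℕ) : Prop :=
  ∀ u, ∃ c, C.Reach u (T (g u.length)) C.init c ∧ C.Halted u c ∧
    c.head (Fin.last b) = g u.length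

/-- The position reached by `C` depends on the length of its input alone, so all translatable
letters are shown to it as the one letter `u`. The word `x` is copied unchanged and decoded when the
copy is read. -/
theorem Constructs.prepares_unpad [Finite β] {C : DTM γ (b + 1)} {g T : ℕ → ℕ}
    (hC : C.Constructs g T) (hg : IsTimeBound g) (dec : β → Option α) (u : γ) :
    (preparer C (fun a => (dec a).map fun _ => u) true).Prepares (Fin.last b)
      (fun s => s.2.elim InSym.rightEnd (decodeSym dec)) (unpad dec)
      {x | x.length = g (unpad dec x).length}
      fun x => T (g (unpad dec x).length) + 3 * g (unpad dec x).length + 7 := by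
  intro x
  have hlen := length_unpad_map dec (fun _ => u) x
  obtain ⟨c, h1, h2, h3⟩ := hC (unpad (fun a => (dec a).map fun _ => u) x)
  rw [hlen] at h1 h3
  obtain ⟨d, h4, h5, h6⟩ := preparer_spec (exact := true) h1 h2 h3 (by rw [hlen]; exact hg.le _)
  refine ⟨d, h4, h5, ?_⟩
  rcases h6 with ⟨h6, ⟨-, h7⟩, h8, h9⟩ | ⟨h6, h7⟩
  · refine Or.inl ⟨h6, h7 rfl, h8, fun p hp => ?_⟩
    have := length_unpad_le dec x
    simp only [h9]
    rw [← h7 rfl, padTape_length _ (by omega)]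
    exact decodeSym_inputAt _ _ hp
  · exact Or.inr ⟨h6, fun h => h7 ⟨(show x.length = _ from h).le, fun _ => h⟩⟩

/-- As `|w| ≤ g |w|` and equality is not demanded, the length check never fails; hence `Set.univ`.
-/
theorem Constructs.prepares_padded [Finite α] {C : DTM γ (b + 1)} {g T : ℕ → ℕ}
    (hC : C.Constructs g T) (hg : IsTimeBound g) (enc : α → β) (pad : β) (u : γ) :
    (preparer C (fun _ : α => some u) false).Prepares (Fin.last b)
      (fun s => readPadded enc pad s.2)
      (fun w => w.map enc ++ List.replicate (g w.length - w.length) pad) Set.univ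
      fun w => T (g w.length) + 3 * g w.length + 7 := by
  intro w
  have hlen := length_unpad_some (fun _ : α => u) w
  obtain ⟨c, h1, h2, h3⟩ := hC (unpad (fun _ => some u) w)
  rw [hlen] at h1 h3
  have hw := hg.le w.length
  obtain ⟨d, h4, h5, h6⟩ := preparer_spec (exact := false) h1 h2 h3 (by rw [hlen]; exact hw)
  refine ⟨d, h4, h5, ?_⟩
  rcases h6 with ⟨h6, -, h8, h9⟩ | ⟨h6, h7⟩
  · refine Or.inl ⟨h6, trivial, h8, fun p hp => ?_⟩
    simp only [h9]
    exact readPadded_padTape _ _ _ hw (by simp at hp; omega)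
  · exact absurd ⟨hw, fun h => by simp at h⟩ h7

end DTM

/-- The words of length `g n` whose unpadded part belongs to `L` and has length `n`. -/
def paddedLanguage (dec : β → Option α) (g : ℕ → ℕ) (L : Language α) : Language β :=
  {x | x.length = g (unpad dec x).length ∧ unpad dec x ∈ L}

open DTM

/-- Padding reduces the time bound. -/
theorem exists_machine_paddedLanguage [Finite β] {f g : ℕ → ℕ} (hf : IsTimeBound f)
    (hg : IsTimeBound g) {C : DTM γ (b + 1)} {c₀ : ℕ} (hC : C.Constructs g fun n => c₀ * (n + 1))
    (u : γ) (dec : β → Option α) {b' : ℕ} {M : DTM α b'} (hM : M.HasTime (f ∘ g)) :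
    ∃ N : DTM β (b + 1 + 1 + b'),
      N.language = paddedLanguage dec g M.language ∧ N.HasTime f := by
  obtain ⟨c₁, hc₁⟩ := (hasTime_iff fun n => (hg.le n).trans (hf.le _)).1 hM
  -- For `x` of the right length, `c₀ * (|x| + 1) + 3 * |x| + 7` is at most `(c₀ + 7) * (|x| + 1)`.
  -- For other `x` the unclocked time is not bounded in terms of `|x|`.
  have hQ := (hC.prepares_unpad hg dec u).clock (c := c₀ + 7) (by
    intro x hx
    have hx : x.length = _ := hx
    rw [← hx]
    nlinarith)
  have hl : ∀ i : Fin b', Fin.natAdd (b + 1 + 1) i ≠ Fin.castAdd b' (Fin.last b).castSucc := by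
    intro i hi
    have := congrArg Fin.val hi
    simp at this
    omega
  have hspec := seqComp_spec (Fin.castAdd_injective _ b') (Fin.natAdd_injective b' _) hl hQ hc₁
  generalize seqComp _ M _ _ _ _ = N at hspec
  -- `c₀ + 7 + 5` for the clocked preparation, `c₁` for `M`, and `1` for the handover.
  refine ⟨N, language_eq_and_hasTime (c := c₀ + c₁ + 13) hf.le fun x => ?_⟩
  have hfx := hf.le x.length
  by_cases hx : x.length = g (unpad dec x).length
  · obtain ⟨d, h1, h2, h3⟩ := (hspec x).1 hx
    refine ⟨d, h1.mono ?_, h2, h3.trans ⟨fun h => ⟨hx, h⟩, fun h => h.2⟩⟩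
    rw [← hx]
    nlinarith
  · obtain ⟨d, h1, h2, h3⟩ := (hspec x).2 hx
    refine ⟨d, h1.mono ?_, h2, iff_of_false h3 fun h => hx h.1⟩
    nlinarith

/-- A machine for the padded language yields a machine for the language itself, with one
additional tape. -/
theorem exists_machine_of_paddedLanguage [Finite α] {f g : ℕ → ℕ} (hf : IsTimeBound f)
    (hg : IsTimeBound g) {C : DTM γ (b + 1)} {c₀ : ℕ} (hC : C.Constructs g fun n => c₀ * (n + 1))
    (u : γ) {dec : β → Option α} {enc : α → β} {pad : β} (hdec : ∀ a, dec (enc a) = some a)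
    (hpad : dec pad = none) {L : Language α} {b' : ℕ} {M : DTM β b'}
    (hML : M.language = paddedLanguage dec g L) (hM : M.HasTime f) :
    ∃ N : DTM α (max b' b + 1), N.language = L ∧ N.HasTime (f ∘ g) := by
  obtain ⟨c₁, hc₁⟩ := (hasTime_iff hf.le).1 hM
  have hQ := hC.prepares_padded hg enc pad u
  -- The preparer occupies the rightmost tapes, so that its last tape is the very last one, which
  -- the leftmost `b'` tapes used by `M` avoid. The other tapes may be shared.
  let e₁ : Fin (b + 1) → Fin (max b' b + 1) :=
    fun i => (Fin.castLE (by omega : b + 1 ≤ max b' b + 1) i.rev).rev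
  let e₂ : Fin b' → Fin (max b' b + 1) := fun i => (Fin.castLE (le_max_left b' b) i).castSucc
  have he₁ : Function.Injective e₁ :=
    Fin.rev_injective.comp ((Fin.castLE_injective _).comp Fin.rev_injective)
  have he₂ : Function.Injective e₂ :=
    (Fin.castSucc_injective _).comp (Fin.castLE_injective _)
  have hl : ∀ i, e₂ i ≠ e₁ (Fin.last b) := by
    intro i hi
    have h1 := congrArg Fin.val hi
    have h2 := i.isLt
    simp [e₁, e₂] at h1
    omega
  have hspec := seqComp_spec he₁ he₂ hl hQ hc₁
  generalize seqComp _ M _ _ _ _ = N at hspec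
  refine ⟨N, language_eq_and_hasTime (c := c₀ + c₁ + 8) (fun n => (hg.le n).trans (hf.le _))
    fun w => ?_⟩
  have hgw := hg.le w.length
  have hfg := hf.le (g w.length)
  have hv : (w.map enc ++ List.replicate (g w.length - w.length) pad).length = g w.length := by
    simp
    omega
  obtain ⟨d, h1, h2, h3⟩ := (hspec w).1 trivial
  refine ⟨d, h1.mono ?_, h2, h3.trans ?_⟩
  · rw [hv, Function.comp_apply]
    nlinarith [Nat.mul_le_mul_left c₀ hfg]
  · rw [hML]
    change (_ = g _ ∧ _ ∈ L) ↔ _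
    rw [unpad_append_replicate hdec hpad, hv]
    exact and_iff_right rfl

end TapeTime

open TapeTime in
theorem lemma3 (f g : ℕ → ℕ) (b₀ bg : ℕ)
    (hf : IsTimeBound f) (hg : IsTimeBound g)
    (hDT : DTIME f = DTIMEWith b₀ f)
    (hcon : TimeConstructibleWith bg g) :
    DTIME (f ∘ g) = DTIMEWith (max b₀ bg + 1) (f ∘ g) := by
  refine Set.Subset.antisymm ?_ (Set.subset_iUnion (fun b => DTIMEWith b (f ∘ g)) _)
  intro L hL
  obtain ⟨b, M, hML, hMT⟩ := Set.mem_iUnion.1 hL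
  obtain ⟨k, C₀, i, one, hone, hCT, hC₀⟩ := hcon
  obtain ⟨c₀, hc₀⟩ := (DTM.hasTime_iff hg.le).1 hCT
  have hC : (C₀.counting i one).Constructs g fun n => c₀ * (n + 1) :=
    DTM.counting_spec hone hc₀ hC₀
  -- The new last letter is the padding letter.
  let dec : Fin (L.1 + 1) → Option (Fin L.1) :=
    Fin.lastCases none some
  -- The letter `0` shown to the constructing machine exists because its alphabet is nonempty.
  obtain ⟨N, hNL, hNT⟩ := exists_machine_paddedLanguage hf hg hC 0 dec hMT
  have hN : (⟨L.1 + 1, paddedLanguage dec g M.language⟩ : FinLanguage) ∈ DTIME f :=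
    Set.mem_iUnion.2 ⟨_, N, hNL, hNT⟩
  -- Here the arbitrary number of tapes is reduced to `b₀`.
  rw [hDT] at hN
  obtain ⟨M', hM'L, hM'T⟩ := hN
  rw [hML] at hM'L
  exact exists_machine_of_paddedLanguage hf hg hC 0 (dec := dec) (enc := Fin.castSucc)
    (pad := Fin.last _) (fun a => by simp [dec]) (by simp [dec]) hM'L hM'T
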